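/- Let $n,k$ be non-negative integers and let $\mathbf P^n$ be the complex projective $n$-space. A *Steiner bundle* in $\mathcal S_{n,k}$ is an algebraic vector bundle $S$ on $\mathbf P^n$ whose dual $S^*$ appears in an exact sequence of vector bundles $$0\longrightarrow S^*\longrightarrow W\otimes\mathcal O_{\mathbf P^n}\longrightarrow I\otimes\mathcal O_{\mathbf P^n}(1)\longrightarrow 0,$$ where $W$ and $I$ are complex vector spaces of dimension $n+k$ and $k$ respectively. A hyperplane $H\subset\mathbf P^n$ (a point of the dual projective space) is an *unstable hyperplane* of $S$ if $h^0(S^*_{|H})\neq 0$, that is, if the restriction of $S^*$ to $H$ has a nonzero global section. Theorem. Let $S$ and $S'$ be two Steiner bundles in $\mathcal S_{n,k}$. If there are $n+k+1$ distinct hyperplanes of $\mathbf P^n$ each of which is an unstable hyperplane both of $S$ and of $S'$, then $S$ and $S'$ are isomorphic as vector bundles on $\mathbf P^n$. -/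

import Mathlib

open scoped LinearAlgebra.Projectivization Topology

noncomputable section

/-! ### Projective space as an algebraic variety over the complex numbers -/

/-- Complex projective `n`-space: the lines through the origin of `ℂⁿ⁺¹`. -/
abbrev ProjSpace (n : ℕ) : Type := ℙ ℂ (Fin (n + 1) → ℂ)

namespace ProjSpace

/-- `h` does not vanish at the point `x`. For homogeneous `h` this does not depend on the chosen
representative of `x`. -/
def NonvanishingAt {n : ℕ} (h : MvPolynomial (Fin (n + 1)) ℂ) (x : ProjSpace n) : Prop :=
  MvPolynomial.eval x.rep h ≠ 0

/-- The Zariski topology on projective space: the complements of the zero loci of homogeneous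
polynomials form a basis of open sets. -/
abbrev zariski (n : ℕ) : TopologicalSpace (ProjSpace n) where
  IsOpen U := ∀ x ∈ U, ∃ (d : ℕ) (h : MvPolynomial (Fin (n + 1)) ℂ), h.IsHomogeneous d ∧
    NonvanishingAt h x ∧ ∀ y, NonvanishingAt h y → y ∈ U
  isOpen_univ := fun _ _ => ⟨0, 1, MvPolynomial.isHomogeneous_one _ _, by simp [NonvanishingAt],
    fun _ _ => trivial⟩
  isOpen_inter := by
    rintro U U' hU hU' x ⟨hx, hx'⟩
    obtain ⟨d, h, hd, hhx, hh⟩ := hU x hx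
    obtain ⟨d', h', hd', hhx', hh'⟩ := hU' x hx'
    refine ⟨d + d', h * h', hd.mul hd', ?_, fun y hy => ?_⟩
    · simp only [NonvanishingAt, map_mul] at *
      exact mul_ne_zero hhx hhx'
    · simp only [NonvanishingAt, map_mul, mul_ne_zero_iff] at *
      exact ⟨hh y hy.1, hh' y hy.2⟩
  isOpen_sUnion := by
    rintro 𝒰 h𝒰 x ⟨U, hU, hx⟩
    obtain ⟨d, h, hd, hhx, hh⟩ := h𝒰 U hU x hx
    exact ⟨d, h, hd, hhx, fun y hy => ⟨U, hU, hh y hy⟩⟩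

/-- A function on a (locally closed) subset `X` of projective space is regular if, locally in the
Zariski topology, it is a quotient of two homogeneous polynomials of the same degree, with
nowhere vanishing denominator. -/
def IsRegularFunction {n : ℕ} {X : Set (ProjSpace n)} (f : X → ℂ) : Prop :=
  ∀ x : X, ∃ U : Set (ProjSpace n), IsOpen[zariski n] U ∧ (x : ProjSpace n) ∈ U ∧
    ∃ (d : ℕ) (p q : MvPolynomial (Fin (n + 1)) ℂ), p.IsHomogeneous d ∧ q.IsHomogeneous d ∧
      ∀ y : X, (y : ProjSpace n) ∈ U → NonvanishingAt q (y : ProjSpace n) ∧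
        f y = MvPolynomial.eval (y : ProjSpace n).rep p / MvPolynomial.eval (y : ProjSpace n).rep q

/-- The hyperplanes of projective `n`-space: the points of the dual projective space. -/
abbrev Hyperplane (n : ℕ) : Type := ℙ ℂ (Module.Dual ℂ (Fin (n + 1) → ℂ))

/-- The set of points of a hyperplane. -/
def Hyperplane.points {n : ℕ} (H : Hyperplane n) : Set (ProjSpace n) :=
  {x | H.rep x.rep = 0}

end ProjSpace

open ProjSpace

/-! ### Algebraic vector bundles -/

/-- An algebraic vector bundle on complex projective `n`-space: a family of complex vector spaces
indexed by the points, with local trivializations over the members of a Zariski open cover such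
that the entries of all transition matrices are regular functions. -/
structure AlgVectorBundle (n : ℕ) where
  /-- the fibres -/
  Fiber : ProjSpace n → Type
  [addCommGroup : ∀ x, AddCommGroup (Fiber x)]
  [module : ∀ x, Module ℂ (Fiber x)]
  /-- the rank -/
  rank : ℕ
  /-- the index set of the trivializing cover -/
  Chart : Type
  /-- the members of the trivializing cover -/
  dom : Chart → Set (ProjSpace n)
  isOpen_dom : ∀ i, IsOpen[zariski n] (dom i)
  cover : ∀ x, ∃ i, x ∈ dom i
  /-- the local trivializations -/
  triv : ∀ (i : Chart) (x : dom i), Fiber x ≃ₗ[ℂ] (Fin rank → ℂ)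
  regular_transition : ∀ (i j : Chart) (a b : Fin rank),
    IsRegularFunction (X := dom i ∩ dom j) fun x =>
      triv j ⟨x, x.2.2⟩ ((triv i ⟨x, x.2.1⟩).symm (Pi.single a 1)) b

namespace AlgVectorBundle

variable {n : ℕ}

instance (E : AlgVectorBundle n) (x : ProjSpace n) : AddCommGroup (E.Fiber x) := E.addCommGroup x

instance (E : AlgVectorBundle n) (x : ProjSpace n) : Module ℂ (E.Fiber x) := E.module x

/-- A section `s` of the restriction of `E` to a (locally closed) subset `X` is regular if its
coordinates in every local trivialization of `E` are regular functions. -/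
def IsRegularSection (E : AlgVectorBundle n) {X : Set (ProjSpace n)}
    (s : ∀ x : X, E.Fiber x) : Prop :=
  ∀ (i : E.Chart) (a : Fin E.rank),
    IsRegularFunction (X := X ∩ E.dom i) fun x => E.triv i ⟨x, x.2.2⟩ (s ⟨x, x.2.1⟩) a

/-- A morphism of vector bundles: a family of linear maps between the fibres, whose matrix entries
in local trivializations are regular functions. -/
structure Hom (E F : AlgVectorBundle n) where
  /-- the linear maps on the fibres -/
  map : ∀ x, E.Fiber x →ₗ[ℂ] F.Fiber x
  regular : ∀ (i : E.Chart) (j : F.Chart) (a : Fin E.rank) (b : Fin F.rank),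
    IsRegularFunction (X := E.dom i ∩ F.dom j) fun x =>
      F.triv j ⟨x, x.2.2⟩ (map x ((E.triv i ⟨x, x.2.1⟩).symm (Pi.single a 1))) b

/-- Two vector bundles are isomorphic if there are mutually inverse morphisms between them. -/
def IsIsomorphic (E F : AlgVectorBundle n) : Prop :=
  ∃ (φ : Hom E F) (ψ : Hom F E), ∀ x,
    ψ.map x ∘ₗ φ.map x = LinearMap.id ∧ φ.map x ∘ₗ ψ.map x = LinearMap.id

/-- A short sequence `0 → E → F → G → 0` of vector bundles is exact if it is so on every fibre
(equivalently, if the sequence of their sheaves of sections is exact). -/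
def IsShortExact {E F G : AlgVectorBundle n} (φ : Hom E F) (ψ : Hom F G) : Prop :=
  ∀ x, Function.Injective (φ.map x) ∧ Function.Exact (φ.map x) (ψ.map x) ∧
    Function.Surjective (ψ.map x)

/-- The dual bundle; a linear form is trivialized by its values on the local frame of `E`. -/
def dual (E : AlgVectorBundle n) : AlgVectorBundle n where
  Fiber x := Module.Dual ℂ (E.Fiber x)
  rank := E.rank
  Chart := E.Chart
  dom := E.dom
  isOpen_dom := E.isOpen_dom
  cover := E.cover
  triv i x := (E.triv i x).symm.dualMap ≪≫ₗ (Module.piEquiv (Fin E.rank) ℂ ℂ).symm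
  regular_transition i j a b := by
    intro x
    obtain ⟨U, hU, hxU, d, p, q, hp, hq, h⟩ :=
      E.regular_transition j i b a ⟨x, x.2.2, x.2.1⟩
    refine ⟨U, hU, hxU, d, p, q, hp, hq, fun y hy => ?_⟩
    obtain ⟨h1, h2⟩ := h ⟨y, y.2.2, y.2.1⟩ hy
    refine ⟨h1, h2 ▸ ?_⟩
    simp [Module.piEquiv, Pi.single_apply]

/-- The trivial bundle `W ⊗ 𝒪` with `W = ℂᵐ`. -/
def trivialBundle (n m : ℕ) : AlgVectorBundle n where
  Fiber _ := Fin m → ℂ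
  rank := m
  Chart := Unit
  dom _ := Set.univ
  isOpen_dom _ := (zariski n).isOpen_univ
  cover _ := ⟨(), Set.mem_univ _⟩
  triv _ _ := LinearEquiv.refl ℂ _
  regular_transition _ _ a b := fun _ =>
    ⟨Set.univ, (zariski n).isOpen_univ, Set.mem_univ _, 0, MvPolynomial.C ((Pi.single a 1 : _ → ℂ) b), 1,
      MvPolynomial.isHomogeneous_C _ _, MvPolynomial.isHomogeneous_one _ _,
      fun _ _ => by simp [NonvanishingAt]⟩

/-- The open set where the `i`-th homogeneous coordinate does not vanish. -/
def coordOpen (n : ℕ) (i : Fin (n + 1)) : Set (ProjSpace n) := {x | x.rep i ≠ 0}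

theorem isOpen_coordOpen (n : ℕ) (i : Fin (n + 1)) : IsOpen[zariski n] (coordOpen n i) :=
  fun x hx => ⟨1, MvPolynomial.X i, MvPolynomial.isHomogeneous_X _ _,
    by simpa [NonvanishingAt, coordOpen] using hx,
    fun y hy => by simpa [NonvanishingAt, coordOpen] using hy⟩

/-- Over the points of `coordOpen n i`, a linear map on the line `x` is given by its value at the
vector of the line whose `i`-th coordinate is `1`. -/
def twistTriv (n k : ℕ) (i : Fin (n + 1)) (x : coordOpen n i) :
    ((x : ProjSpace n).submodule →ₗ[ℂ] (Fin k → ℂ)) ≃ₗ[ℂ] (Fin k → ℂ) where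
  toFun l := l ⟨((x : ProjSpace n).rep i)⁻¹ • (x : ProjSpace n).rep, by
    rw [Projectivization.submodule_eq]
    exact Submodule.smul_mem _ _ (Submodule.mem_span_singleton_self _)⟩
  map_add' _ _ := rfl
  map_smul' _ _ := rfl
  invFun c := (LinearMap.toSpanSingleton ℂ (Fin k → ℂ) c) ∘ₗ (LinearMap.proj i) ∘ₗ
    (x : ProjSpace n).submodule.subtype
  left_inv l := by
    have hx : (x : ProjSpace n).rep i ≠ 0 := x.2
    ext1 ⟨u, hu⟩
    have hu' := hu
    rw [Projectivization.submodule_eq, Submodule.mem_span_singleton] at hu'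
    obtain ⟨t, rfl⟩ := hu'
    simp only [LinearMap.comp_apply, LinearMap.toSpanSingleton_apply, Submodule.subtype_apply,
      LinearMap.proj_apply, ← map_smul]
    congr 1
    ext a
    simp
    field_simp
  right_inv c := by
    have hx : (x : ProjSpace n).rep i ≠ 0 := x.2
    ext a
    simp [hx]

/-- The bundle `I ⊗ 𝒪(1)` with `I = ℂᵏ`: its fibre at a point `x` consists of the linear maps from
the line `x` to `I`, since `𝒪(1)` is the dual of the tautological line bundle. -/
def twist (n k : ℕ) : AlgVectorBundle n where
  Fiber x := x.submodule →ₗ[ℂ] (Fin k → ℂ)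
  rank := k
  Chart := Fin (n + 1)
  dom := coordOpen n
  isOpen_dom := isOpen_coordOpen n
  cover x := Function.ne_iff.mp x.rep_nonzero
  triv := twistTriv n k
  regular_transition i j a b := fun x =>
    ⟨coordOpen n j, isOpen_coordOpen n j, x.2.2, 1,
      MvPolynomial.C ((Pi.single a 1 : _ → ℂ) b) * MvPolynomial.X i, MvPolynomial.X j,
      by simpa using (MvPolynomial.isHomogeneous_C _ _).mul (MvPolynomial.isHomogeneous_X _ i),
      MvPolynomial.isHomogeneous_X _ _, fun y hy => ⟨by
        simpa [NonvanishingAt, coordOpen] using hy, by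
        simp [twistTriv]
        ring⟩⟩

/-! ### Steiner bundles and unstable hyperplanes -/

/-- `S` belongs to `𝒮ₙ,ₖ`: there is an exact sequence
`0 → S* → W ⊗ 𝒪 → I ⊗ 𝒪(1) → 0` with `dim W = n + k` and `dim I = k`. -/
def IsSteiner (n k : ℕ) (S : AlgVectorBundle n) : Prop :=
  ∃ (φ : Hom S.dual (trivialBundle n (n + k))) (f : Hom (trivialBundle n (n + k)) (twist n k)),
    IsShortExact φ f

/-- The set `W(S)` of the unstable hyperplanes of `S`: those `H` for which the restriction of `S*`
to `H` has a nonzero regular section. -/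
def unstableHyperplanes (S : AlgVectorBundle n) : Set (Hyperplane n) :=
  {H | ∃ s : ∀ x : H.points, S.dual.Fiber x, S.dual.IsRegularSection s ∧ s ≠ 0}

end AlgVectorBundle

end

/-!
Let `n ≥ 1`; for `n = 0` there are no unstable hyperplanes. A Steiner bundle `S` is given by a
bilinear map `A : V × W → I` with `V = ℂⁿ⁺¹`, `W = ℂⁿ⁺ᵏ`, `I = ℂᵏ` such that
`A v : W → I` is surjective for `v ≠ 0`: the global sections of `𝒪(1)` are the linear forms on `V`,
and the fibre of `S*` at the line through `v` is `ker (A v)`. A regular function on a hyperplane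
`ξ = 0` is constant, so that this hyperplane is unstable if and only if there are `w ≠ 0` in `W` and
`y` in `I` with `A v w = ξ v • y` for all `v`.

Now let `ξ j` be `n + k + 1` pairwise independent linear forms with such `w j` and `y j`, and let
`k ≥ 2`. The key point (`Steiner.linearIndepOn_of_card_le`) is that any `n + k` of the `w j` are
linearly independent. It rests on Hopf's lemma: a bilinear map without zero divisors, from the
product of nonzero spaces of dimensions `a` and `b` over an algebraically closed field, takes values
in a space of dimension at least `a + b - 1`. Hopf's lemma is Krull's height theorem applied to the
irrelevant ideal of the homogeneous coordinate ring of a Segre variety.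

Consequently the `w j` can be rescaled such that `∑ j, w j = 0` is their only relation. Then `I*` is
identified with the space of relations of the `ξ j` by `φ ↦ (φ (y j))` (both have dimension `k`), so
that the `ξ j` alone determine which combinations of the `w j` lie in `ker (A v)`
(`Steiner.sum_smul_eq_zero_iff`). For another Steiner bundle with the same `ξ j`, the automorphism of
`W` that matches the two families `w j` therefore matches the kernels. If `k = 1`, then `A` is a
perfect pairing, and if `k = 0`, then it is zero, so that such an automorphism exists in any case. It
induces an isomorphism `S* ≅ S'*` on the fibres, which is regular by Cramer's rule, and the transpose
of its inverse is an isomorphism `S ≅ S'`.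
-/

/-! ### Segre varieties and the lemma of Hopf -/

namespace Segre

open MvPolynomial

variable (K : Type*) [Field K] (a b : ℕ)

/-- The parametrization `z i j ↦ x i * y j` of the matrices of rank at most one, with `x i` and
`y j` the variables indexed by `Sum.inl i` and `Sum.inr j`. Its range is the homogeneous coordinate
ring of the Segre variety `ℙᵃ × ℙᵇ`. -/
noncomputable def param : MvPolynomial (Fin (a + 1) × Fin (b + 1)) K →ₐ[K]
    MvPolynomial (Fin (a + 1) ⊕ Fin (b + 1)) K :=
  aeval fun z => X (Sum.inl z.1) * X (Sum.inr z.2)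

/-- The variables that are set to zero after `t` steps. Each step removes one more variable: first
`x 0, …, x (a - 1)`, then `y 0, …, y b`. The variable `x a` is never removed. -/
noncomputable def killed (t : ℕ) : Fin (a + 1) ⊕ Fin (b + 1) → Prop
  | Sum.inl i => (i : ℕ) < a ∧ (i : ℕ) < t
  | Sum.inr j => a + j < t

open Classical in
/-- The substitution that sets to zero the variables in `killed a b t`. -/
noncomputable def kill (t : ℕ) : MvPolynomial (Fin (a + 1) ⊕ Fin (b + 1)) K →ₐ[K]
    MvPolynomial (Fin (a + 1) ⊕ Fin (b + 1)) K :=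
  aeval fun v => if killed a b t v then 0 else X v

/-- The prime of the Segre ring formed by the elements that vanish after the substitution
`kill K a b t`. -/
noncomputable def flag (t : ℕ) : Ideal (param K a b).range :=
  RingHom.ker ((kill K a b t).comp (param K a b).range.val)

instance (t : ℕ) : (flag K a b t).IsPrime := RingHom.ker_isPrime _

variable {K a b}

theorem mem_flag {t : ℕ} {f : (param K a b).range} :
    f ∈ flag K a b t ↔ kill K a b t f = 0 := Iff.rfl

theorem kill_X {t : ℕ} {v : Fin (a + 1) ⊕ Fin (b + 1)} (h : killed a b t v) :
    kill K a b t (X v) = 0 := by simp [kill, h]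

theorem kill_X_of_not {t : ℕ} {v : Fin (a + 1) ⊕ Fin (b + 1)} (h : ¬ killed a b t v) :
    kill K a b t (X v) = X v := by simp [kill, h]

theorem killed_succ {t : ℕ} {v : Fin (a + 1) ⊕ Fin (b + 1)} (h : killed a b t v) :
    killed a b (t + 1) v := by
  cases v <;> simp only [killed] at * <;> omega

theorem kill_succ_comp (t : ℕ) : (kill K a b (t + 1)).comp (kill K a b t) = kill K a b (t + 1) := by
  ext1 v
  by_cases h : killed a b t v
  · simp [kill_X h, kill_X (killed_succ h)]
  · simp [kill_X_of_not h]

theorem flag_lt_succ {t : ℕ} (ht : t ≤ a + b) : flag K a b t < flag K a b (t + 1) := by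
  have hle : flag K a b t ≤ flag K a b (t + 1) := by
    intro f hf
    rw [mem_flag] at *
    rw [← kill_succ_comp, AlgHom.comp_apply, hf, map_zero]
  -- the product of the variable killed at step `t + 1` with a surviving variable of the other group
  have key : ∃ (i : Fin (a + 1)) (j : Fin (b + 1)),
      (killed a b (t + 1) (Sum.inl i) ∨ killed a b (t + 1) (Sum.inr j)) ∧
      ¬ killed a b t (Sum.inl i) ∧ ¬ killed a b t (Sum.inr j) := by
    by_cases h : t < a
    · refine ⟨⟨t, by omega⟩, Fin.last b, ?_⟩
      simp only [killed, Fin.val_last]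
      omega
    · refine ⟨Fin.last a, ⟨t - a, by omega⟩, ?_⟩
      simp only [killed, Fin.val_last]
      omega
  obtain ⟨i, j, h1, h2, h3⟩ := key
  refine lt_of_le_of_ne hle fun heq => ?_
  have hmem : (⟨X (Sum.inl i) * X (Sum.inr j), X (i, j), by simp [param]⟩ :
      (param K a b).range) ∈ flag K a b (t + 1) := by
    rw [mem_flag, map_mul]
    rcases h1 with h1 | h1
    · rw [kill_X h1, zero_mul]
    · rw [kill_X h1, mul_zero]
  rw [← heq, mem_flag, map_mul, kill_X_of_not h2, kill_X_of_not h3] at hmem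
  exact mul_ne_zero (X_ne_zero _) (X_ne_zero _) hmem

theorem le_height_flag {t : ℕ} (ht : t ≤ a + b + 1) : (t : ℕ∞) ≤ (flag K a b t).height := by
  induction t with
  | zero => simp
  | succ t ih =>
    calc ((t + 1 : ℕ) : ℕ∞) = t + 1 := by push_cast; rfl
      _ ≤ (flag K a b t).height + 1 := by gcongr; exact ih (by omega)
      _ ≤ _ := Ideal.height_add_one_le_of_lt_of_isPrime (flag_lt_succ (by omega))

/-- The last substitution leaves only the constant term: the last member of the flag is the
irrelevant ideal of the Segre ring. -/
theorem kill_param (f : MvPolynomial (Fin (a + 1) × Fin (b + 1)) K) :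
    kill K a b (a + b + 1) (param K a b f) = C (constantCoeff f) := by
  have : (kill K a b (a + b + 1)).comp (param K a b) =
      (Algebra.ofId K _).comp (aeval (fun _ => (0 : K))) := by
    ext1 z
    have h : killed a b (a + b + 1) (Sum.inr z.2) := by simp only [killed]; omega
    simp [param, kill_X h]
  have h2 := DFunLike.congr_fun this f
  simpa [Algebra.ofId_apply, aeval_zero', algebraMap_eq] using h2

/-- A family of bilinear forms in `a + 1` and `b + 1` variables with no common zero on
`ℙᵃ × ℙᵇ` has at least `a + b + 1` members: by the Nullstellensatz the irrelevant ideal is minimal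
over the ideal that they generate in the Segre ring, and its height is at least `a + b + 1`. -/
theorem add_le_of_forall_bilinear [IsAlgClosed K] {r : ℕ}
    (c : Fin r → Fin (a + 1) → Fin (b + 1) → K)
    (hc : ∀ (x : Fin (a + 1) → K) (y : Fin (b + 1) → K),
      (∀ l, ∑ i, ∑ j, c l i j * (x i * y j) = 0) → x = 0 ∨ y = 0) : a + b + 1 ≤ r := by
  let B : Fin r → MvPolynomial (Fin (a + 1) × Fin (b + 1)) K := fun l =>
    ∑ i, ∑ j, C (c l i j) * X (i, j)
  let S : Set (param K a b).range := Set.range fun l => (param K a b).rangeRestrict (B l)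
  have hnoeth : IsNoetherianRing (param K a b).range :=
    isNoetherianRing_of_surjective _ _ (param K a b).rangeRestrict.toRingHom
      (param K a b).rangeRestrict_surjective
  have hmin : flag K a b (a + b + 1) ∈ (Ideal.span S).minimalPrimes := by
    refine ⟨⟨inferInstance, ?_⟩, ?_⟩
    · rw [Ideal.span_le]
      rintro _ ⟨l, rfl⟩
      change _ = _
      have := kill_param (B l)
      simpa [B] using this
    · rintro q ⟨hq, hSq⟩ - ⟨_, f, rfl⟩ hf
      let q' : Ideal (MvPolynomial (Fin (a + 1) × Fin (b + 1)) K) :=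
        q.comap (param K a b).rangeRestrict.toRingHom
      have hq' : q'.IsPrime := Ideal.IsPrime.comap _
      have hker : ∀ g, param K a b g = 0 → g ∈ q' := by
        intro g hg
        have : (param K a b).rangeRestrict g = 0 := Subtype.ext hg
        change (param K a b).rangeRestrict g ∈ q
        rw [this]
        exact zero_mem _
      have hX : ∀ z, X z ∈ q' := by
        intro z
        rw [← MvPolynomial.IsPrime.vanishingIdeal_zeroLocus (K := K) q', mem_vanishingIdeal_iff]
        intro m hm
        rw [mem_zeroLocus_iff] at hm
        rw [aeval_X]
        by_contra hz
        have h2 : ∀ i j, m (i, j) * m z = m (i, z.2) * m (z.1, j) := by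
          intro i j
          have := hm (X (i, j) * X z - X (i, z.2) * X (z.1, j)) (hker _ (by simp [param]; ring))
          simpa [sub_eq_zero] using this
        have h3 := hc (fun i => m (i, z.2)) (fun j => m (z.1, j) / m z) fun l => by
          have := hm (B l) (hSq (Ideal.subset_span ⟨l, rfl⟩))
          simp only [B, map_sum, map_mul, aeval_X, aeval_C, Algebra.algebraMap_self,
            RingHom.id_apply] at this
          rw [← this]
          refine Finset.sum_congr rfl fun i _ => Finset.sum_congr rfl fun j _ => ?_
          rw [← mul_div_assoc, ← h2, mul_div_cancel_right₀ _ hz]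
        rcases h3 with h3 | h3
        · exact hz (congrFun h3 z.1)
        · have := congrFun h3 z.2
          simp [hz] at this
      have hf0 : constantCoeff f = 0 := by
        have h1 : kill K a b (a + b + 1) (param K a b f) = 0 := hf
        rwa [kill_param, C_eq_zero] at h1
      have hmk : Ideal.Quotient.mkₐ K q' =
          (Algebra.ofId K _).comp (aeval (fun _ => (0 : K))) := by
        ext1 z
        simpa using Ideal.Quotient.eq_zero_iff_mem.mpr (hX z)
      have h4 := DFunLike.congr_fun hmk f
      have h5 : f ∈ q' := by
        rw [← Ideal.Quotient.eq_zero_iff_mem]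
        simpa [aeval_zero', hf0] using h4
      exact h5
  have h1 := Ideal.height_le_card_of_mem_minimalPrimes_span (Set.finite_range _) hmin
  have h2 : S.ncard ≤ r := by
    simpa [S, Set.image_univ] using Set.ncard_image_le (s := Set.univ)
      (f := fun l => (param K a b).rangeRestrict (B l))
  have h3 : ((a + b + 1 : ℕ) : ℕ∞) ≤ (r : ℕ∞) :=
    ((le_height_flag le_rfl).trans h1).trans (Nat.cast_le.mpr h2)
  exact Nat.cast_le.mp h3

end Segre

/-- **Hopf's lemma**: over an algebraically closed field, a bilinear map without zero divisors
from the product of nonzero spaces of dimensions `a` and `b` takes values in a space of dimension at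
least `a + b - 1`. Here it is stated for the restriction of a bilinear map to subspaces. -/
theorem LinearMap.finrank_add_finrank_le_of_forall_ne_zero {K X Y Z : Type*} [Field K]
    [IsAlgClosed K] [AddCommGroup X] [Module K X] [AddCommGroup Y] [Module K Y] [AddCommGroup Z]
    [Module K Z] [FiniteDimensional K X] [FiniteDimensional K Y] [FiniteDimensional K Z]
    (B : X →ₗ[K] Y →ₗ[K] Z) {P : Submodule K X} {Q : Submodule K Y} {R : Submodule K Z}
    (hP : P ≠ ⊥) (hQ : Q ≠ ⊥) (hR : ∀ x ∈ P, ∀ y ∈ Q, B x y ∈ R)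
    (hB : ∀ x ∈ P, ∀ y ∈ Q, B x y = 0 → x = 0 ∨ y = 0) :
    Module.finrank K P + Module.finrank K Q ≤ Module.finrank K R + 1 := by
  obtain ⟨a, ha⟩ := Nat.exists_eq_succ_of_ne_zero (Submodule.finrank_eq_zero.not.mpr hP)
  obtain ⟨b, hb⟩ := Nat.exists_eq_succ_of_ne_zero (Submodule.finrank_eq_zero.not.mpr hQ)
  let eP := Module.finBasisOfFinrankEq K P ha
  let eQ := Module.finBasisOfFinrankEq K Q hb
  let eR := Module.finBasis K R
  have := Segre.add_le_of_forall_bilinear (K := K) (a := a) (b := b)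
    (fun l i j => eR.repr ⟨B (eP i) (eQ j), hR _ (eP i).2 _ (eQ j).2⟩ l) ?_
  · rw [ha, hb]
    omega
  · intro x y h
    have hsum : B (∑ i, x i • eP i : P) (∑ j, y j • eQ j : Q) =
        (∑ i, ∑ j, (x i * y j) • (⟨B (eP i) (eQ j), hR _ (eP i).2 _ (eQ j).2⟩ : R) : R) := by
      simp only [Submodule.coe_sum, Submodule.coe_smul, map_sum, LinearMap.sum_apply, map_smul,
        LinearMap.smul_apply, Finset.smul_sum, mul_smul]
      rw [Finset.sum_comm]
      exact Finset.sum_congr rfl fun i _ => Finset.sum_congr rfl fun j _ => smul_comm _ _ _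
    have hzero : (∑ i, ∑ j, (x i * y j) • (⟨B (eP i) (eQ j), hR _ (eP i).2 _ (eQ j).2⟩ : R) : R)
        = 0 := by
      apply eR.repr.injective
      ext l
      simp only [map_sum, map_smul, Finsupp.coe_finsetSum, Finset.sum_apply, Finsupp.smul_apply,
        smul_eq_mul, map_zero, Finsupp.coe_zero, Pi.zero_apply]
      rw [← h l]
      exact Finset.sum_congr rfl fun i _ => Finset.sum_congr rfl fun j _ => mul_comm _ _
    rw [hzero, Submodule.coe_zero] at hsum
    rcases hB _ (Subtype.prop _) _ (Subtype.prop _) hsum with h0 | h0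
    · left
      rw [Submodule.coe_eq_zero] at h0
      funext i
      exact Fintype.linearIndependent_iff.mp eP.linearIndependent x h0 i
    · right
      rw [Submodule.coe_eq_zero] at h0
      funext j
      exact Fintype.linearIndependent_iff.mp eQ.linearIndependent y h0 j

/-! ### Bilinear maps of Steiner type -/

namespace Steiner

open Module

variable {K V W I ι : Type*} [Field K] [AddCommGroup V] [Module K V] [AddCommGroup W] [Module K W]
  [AddCommGroup I] [Module K I]

/-- The bilinear map `(φ, v) ↦ φ ∘ A v`. -/
def transpose (A : V →ₗ[K] W →ₗ[K] I) : Dual K I →ₗ[K] V →ₗ[K] Dual K W :=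
  LinearMap.mk₂ K (fun φ v => φ ∘ₗ A v) (by intros; ext; simp) (by intros; ext; simp)
    (by intros; ext; simp) (by intros; ext; simp)

@[simp]
theorem transpose_apply (A : V →ₗ[K] W →ₗ[K] I) (φ : Dual K I) (v : V) (w : W) :
    transpose A φ v w = φ (A v w) := rfl

theorem eq_zero_or_eq_zero_of_transpose_eq_zero {A : V →ₗ[K] W →ₗ[K] I}
    (hA : ∀ v ≠ 0, Function.Surjective (A v)) {φ : Dual K I} {v : V}
    (h : transpose A φ v = 0) : φ = 0 ∨ v = 0 := by
  by_contra! hc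
  refine hc.1 (LinearMap.ext fun y => ?_)
  obtain ⟨w, rfl⟩ := hA v hc.2 y
  exact LinearMap.congr_fun h w

theorem finrank_span_image_eq_card {w : ι → W} {J : Finset ι} (h : LinearIndepOn K w (J : Set ι)) :
    finrank K (Submodule.span K (w '' (J : Set ι))) = J.card := by
  rw [Set.image_eq_range]
  exact (finrank_span_eq_card (R := K) (b := fun j : J => w j) h).trans (Fintype.card_coe J)

/-- Let `A v (w j) = ξ j v • i j` with pairwise independent linear forms `ξ j` and nonzero `w j`.
If `dim I ≥ 2` then any `dim W` of the vectors `w j` are linearly independent. A minimal relation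
`∑ c j • w j = 0` embeds the dual of the span of the `i j` into the relations of the `ξ j`, and
Hopf's lemma, applied to the annihilators of the `i j`, the `ξ j` and the `w j`, excludes it. -/
theorem linearIndepOn_of_card_le [IsAlgClosed K] [FiniteDimensional K V] [FiniteDimensional K W]
    [FiniteDimensional K I] {A : V →ₗ[K] W →ₗ[K] I} (hA : ∀ v ≠ 0, Function.Surjective (A v))
    (hdim : finrank K W + 1 = finrank K V + finrank K I) (hI : 2 ≤ finrank K I)
    {w : ι → W} {ξ : ι → Dual K V} {i : ι → I} (hw : ∀ j, w j ≠ 0)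
    (hξ : ∀ j j', j ≠ j' → LinearIndependent K ![ξ j, ξ j'])
    (h : ∀ v j, A v (w j) = ξ j v • i j) (J : Finset ι) (hJ : J.card ≤ finrank K W) :
    LinearIndepOn K w (J : Set ι) := by
  classical
  induction J using Finset.strongInduction with
  | H J ih =>
    rw [linearIndepOn_finset_iff]
    by_contra! hc
    obtain ⟨c, hsum, j₀, hj₀, hcj₀⟩ := hc
    have herase : ∀ j ∈ J, LinearIndepOn K w ((J.erase j : Finset ι) : Set ι) := fun j hj =>
      ih _ (Finset.erase_ssubset hj) ((Finset.card_erase_le).trans hJ)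
    -- the relation is a circuit: all its coefficients are nonzero
    have hc : ∀ j ∈ J, c j ≠ 0 := by
      intro j hj hcj
      have hne : j₀ ≠ j := fun e => hcj₀ (e ▸ hcj)
      refine hcj₀ (linearIndepOn_finset_iff.mp (herase j hj) c ?_ j₀
        (Finset.mem_erase.mpr ⟨hne, hj₀⟩))
      rw [← hsum, ← Finset.add_sum_erase _ _ hj, hcj, zero_smul, zero_add]
    obtain ⟨j₁, hj₁, hne⟩ : ∃ j₁ ∈ J, j₁ ≠ j₀ := by
      by_contra! hall
      rw [Finset.eq_singleton_iff_unique_mem.mpr ⟨hj₀, hall⟩, Finset.sum_singleton] at hsum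
      exact (smul_ne_zero hcj₀ (hw j₀)) hsum
    have hcard : 1 ≤ J.card := Finset.card_pos.mpr ⟨j₀, hj₀⟩
    let P : (J → K) →ₗ[K] Dual K V := Fintype.linearCombination K fun j : J => ξ j
    let Q : Dual K I →ₗ[K] (J → K) := LinearMap.pi fun j => c j • Dual.eval K I (i j)
    let R : Submodule K (Dual K W) :=
      (Submodule.span K (w '' (J.erase j₀ : Finset ι))).dualAnnihilator
    have hQ : ∀ φ j, Q φ j = c j * φ (i j) := fun φ j => rfl
    have hP : ∀ x v, P x v = ∑ j : J, x j * ξ j v := fun x v => by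
      simp [P, Fintype.linearCombination_apply, LinearMap.sum_apply]
    have hQP : LinearMap.range Q ≤ LinearMap.ker P := by
      rintro _ ⟨φ, rfl⟩
      rw [LinearMap.mem_ker]
      ext v
      have h1 : A v (∑ j ∈ J, c j • w j) = 0 := by rw [hsum, map_zero]
      have h2 := congrArg φ h1
      rw [map_sum, map_sum, map_zero, ← Finset.sum_coe_sort] at h2
      rw [hP, LinearMap.zero_apply, ← h2]
      refine Finset.sum_congr rfl fun j _ => ?_
      rw [hQ, map_smul, h, map_smul, map_smul, smul_eq_mul, smul_eq_mul]
      ring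
    have hQrank := LinearMap.finrank_range_add_finrank_ker Q
    have hPrank := LinearMap.finrank_range_add_finrank_ker P
    have hle := Submodule.finrank_mono hQP
    rw [Subspace.dual_finrank_eq] at hQrank
    rw [Module.finrank_fintype_fun_eq_card, Fintype.card_coe] at hPrank
    have hPtwo : 2 ≤ finrank K (LinearMap.range P) := by
      have h1 := finrank_span_eq_card (hξ _ _ hne)
      rw [Fintype.card_fin] at h1
      refine h1.ge.trans ?_
      refine Submodule.finrank_mono (Submodule.span_le.mpr ?_)
      rintro _ ⟨t, rfl⟩
      have hmem : ∀ j ∈ J, ξ j ∈ LinearMap.range P := fun j hj =>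
        ⟨Pi.single ⟨j, hj⟩ 1, by simp [P]⟩
      fin_cases t
      · exact hmem j₁ hj₁
      · exact hmem j₀ hj₀
    have hRrank : finrank K R + J.card = finrank K W + 1 := by
      have h1 := Subspace.finrank_add_finrank_dualAnnihilator_eq
        (Submodule.span K (w '' (J.erase j₀ : Finset ι)))
      have h2 := finrank_span_image_eq_card (herase j₀ hj₀)
      rw [Finset.card_erase_of_mem hj₀] at h2
      change _ + finrank K R = _ at h1
      omega
    have hR : ∀ φ v, (∀ j ∈ J, ξ j v * φ (i j) = 0) → transpose A φ v ∈ R := by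
      intro φ v hv
      refine (Submodule.mem_dualAnnihilator _).mpr fun x hx => ?_
      refine Submodule.span_induction ?_ (by simp) (fun _ _ _ _ h1 h2 => by rw [map_add, h1, h2,
        add_zero]) (fun _ _ _ h1 => by rw [map_smul, h1, smul_zero]) hx
      rintro _ ⟨j, hj, rfl⟩
      rw [transpose_apply, h, map_smul, smul_eq_mul]
      exact hv j (Finset.mem_of_mem_erase hj)
    have hopf := fun (P' : Submodule K (Dual K I)) (Q' : Submodule K V) h1 h2 h3 =>
      LinearMap.finrank_add_finrank_le_of_forall_ne_zero (transpose A) (P := P') (Q := Q') (R := R)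
        h1 h2 h3 fun _ _ _ _ => eq_zero_or_eq_zero_of_transpose_eq_zero hA
    have hVne : (⊤ : Submodule K V) ≠ ⊥ := by
      intro h0
      have h1 : finrank K (⊤ : Submodule K V) = 0 := by rw [h0, finrank_bot]
      have h2 := Submodule.finrank_le (LinearMap.range P)
      rw [finrank_top] at h1
      rw [Subspace.dual_finrank_eq] at h2
      omega
    by_cases hker : LinearMap.ker Q = ⊥
    · -- the `i j` span `I`, so the `ξ j` have a common zero
      have hk0 : finrank K (LinearMap.ker Q) = 0 := by rw [hker, finrank_bot]
      have h1 := Subspace.finrank_add_finrank_dualCoannihilator_eq (LinearMap.range P)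
      have hne' : (LinearMap.range P).dualCoannihilator ≠ ⊥ := by
        intro h0
        rw [h0, finrank_bot] at h1
        omega
      have hDne : (⊤ : Submodule K (Dual K I)) ≠ ⊥ := by
        intro h0
        have h1 : finrank K (⊤ : Submodule K (Dual K I)) = 0 := by rw [h0, finrank_bot]
        rw [finrank_top, Subspace.dual_finrank_eq] at h1
        omega
      have h2 := hopf ⊤ (LinearMap.range P).dualCoannihilator hDne hne' fun φ _ v hv =>
        hR φ v fun j hj => by
          rw [Submodule.mem_dualCoannihilator] at hv
          rw [hv (ξ j) ⟨Pi.single ⟨j, hj⟩ 1, by simp [P]⟩, zero_mul]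
      rw [finrank_top, Subspace.dual_finrank_eq] at h2
      omega
    · have h2 := hopf (LinearMap.ker Q) ⊤ hker hVne fun φ hφ v _ => hR φ v fun j hj => by
        have h3 := congrFun (LinearMap.mem_ker.mp hφ) ⟨j, hj⟩
        rw [hQ, Pi.zero_apply] at h3
        rw [(mul_eq_zero.mp h3).resolve_left (hc j hj), mul_zero]
      rw [finrank_top] at h2
      omega

/-- With `dim W + 1` vectors `w j`, rescaling makes `∑ j, w j = 0` their only relation. -/
theorem exists_sum_eq_zero [IsAlgClosed K] [FiniteDimensional K V] [FiniteDimensional K W]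
    [FiniteDimensional K I] [Fintype ι] {A : V →ₗ[K] W →ₗ[K] I}
    (hA : ∀ v ≠ 0, Function.Surjective (A v))
    (hdim : finrank K W + 1 = finrank K V + finrank K I) (hI : 2 ≤ finrank K I)
    (hι : Fintype.card ι = finrank K W + 1)
    {w : ι → W} {ξ : ι → Dual K V} {i : ι → I} (hw : ∀ j, w j ≠ 0)
    (hξ : ∀ j j', j ≠ j' → LinearIndependent K ![ξ j, ξ j'])
    (h : ∀ v j, A v (w j) = ξ j v • i j) :
    ∃ (w' : ι → W) (i' : ι → I), (∀ v j, A v (w' j) = ξ j v • i' j) ∧ ∑ j, w' j = 0 ∧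
      Submodule.span K (Set.range w') = ⊤ := by
  classical
  have hind := linearIndepOn_of_card_le hA hdim hI hw hξ h
  have hdep : ¬ LinearIndependent K w := fun h0 => by
    have := h0.fintype_card_le_finrank
    omega
  obtain ⟨c, hsum, j₀, hcj₀⟩ := Fintype.not_linearIndependent_iff.mp hdep
  have herase : ∀ j, LinearIndepOn K w ((Finset.univ.erase j : Finset ι) : Set ι) := fun j =>
    hind _ (by rw [Finset.card_erase_of_mem (Finset.mem_univ j), Finset.card_univ]; omega)
  have hc : ∀ j, c j ≠ 0 := by
    intro j hcj
    have hne : j₀ ≠ j := fun e => hcj₀ (e ▸ hcj)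
    refine hcj₀ (linearIndepOn_finset_iff.mp (herase j) c ?_ j₀
      (Finset.mem_erase.mpr ⟨hne, Finset.mem_univ _⟩))
    rw [← hsum, ← Finset.add_sum_erase _ _ (Finset.mem_univ j), hcj, zero_smul, zero_add]
  refine ⟨fun j => c j • w j, fun j => c j • i j, fun v j => ?_, hsum, ?_⟩
  · rw [map_smul, h, smul_comm]
  · have h1 : Submodule.span K (w '' (Finset.univ.erase j₀ : Finset ι)) = ⊤ := by
      apply Submodule.eq_top_of_finrank_eq
      have h2 := finrank_span_image_eq_card (herase j₀)
      rw [Finset.card_erase_of_mem (Finset.mem_univ _), Finset.card_univ] at h2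
      omega
    rw [eq_top_iff, ← h1, Submodule.span_le]
    rintro _ ⟨j, -, rfl⟩
    have h2 : w j = (c j)⁻¹ • c j • w j := by rw [smul_smul, inv_mul_cancel₀ (hc j), one_smul]
    rw [h2]
    exact Submodule.smul_mem _ _ (Submodule.subset_span ⟨j, rfl⟩)

/-- The relations of the `i j` are determined by the linear forms `ξ j`: the coordinates of the
linear forms on `I` at the `i j` are exactly the relations of the `ξ j`. -/
theorem sum_smul_eq_zero_iff [FiniteDimensional K V] [FiniteDimensional K I]
    [Fintype ι] [Nontrivial V] [Nontrivial I] {A : V →ₗ[K] W →ₗ[K] I}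
    (hA : ∀ v ≠ 0, Function.Surjective (A v))
    (hι : Fintype.card ι = finrank K V + finrank K I) {w : ι → W} {ξ : ι → Dual K V} {i : ι → I}
    (h : ∀ v j, A v (w j) = ξ j v • i j) (hsum : ∑ j, w j = 0)
    (hspan : Submodule.span K (Set.range w) = ⊤) (d : ι → K) :
    ∑ j, d j • i j = 0 ↔ ∀ x : ι → K, ∑ j, x j • ξ j = 0 → ∑ j, d j * x j = 0 := by
  classical
  let P : (ι → K) →ₗ[K] Dual K V := Fintype.linearCombination K ξ
  let Q : Dual K I →ₗ[K] (ι → K) := LinearMap.pi fun j => Dual.eval K I (i j)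
  have hP : ∀ x, P x = ∑ j, x j • ξ j := fun x => Fintype.linearCombination_apply K ξ x
  have hQ : ∀ φ j, Q φ j = φ (i j) := fun φ j => rfl
  have hQP : LinearMap.range Q ≤ LinearMap.ker P := by
    rintro _ ⟨φ, rfl⟩
    rw [LinearMap.mem_ker, hP]
    ext v
    have h2 : φ (A v (∑ j, w j)) = 0 := by rw [hsum, map_zero, map_zero]
    rw [map_sum, map_sum] at h2
    rw [LinearMap.zero_apply, ← h2, LinearMap.sum_apply]
    refine Finset.sum_congr rfl fun j _ => ?_
    rw [LinearMap.smul_apply, hQ, h, map_smul, smul_eq_mul, smul_eq_mul, mul_comm]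
  have hQinj : Function.Injective Q := by
    rw [injective_iff_map_eq_zero]
    intro φ hφ
    obtain ⟨v, hv⟩ := exists_ne (0 : V)
    have h1 : φ ∘ₗ A v = 0 := by
      refine LinearMap.ext_on_range hspan fun j => ?_
      have h2 := congrFun hφ j
      rw [hQ, Pi.zero_apply] at h2
      rw [LinearMap.comp_apply, h, map_smul, h2, smul_zero, LinearMap.zero_apply]
    exact (eq_zero_or_eq_zero_of_transpose_eq_zero hA h1).resolve_right hv
  have hPsurj : LinearMap.range P = ⊤ := by
    have h1 : (LinearMap.range P).dualCoannihilator = ⊥ := by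
      rw [eq_bot_iff]
      intro v hv
      by_contra hv0
      rw [Submodule.mem_dualCoannihilator] at hv
      have h2 : A v = 0 := by
        refine LinearMap.ext_on_range hspan fun j => ?_
        rw [h, hv (ξ j) ⟨Pi.single j 1, by simp [P]⟩, zero_smul, LinearMap.zero_apply]
      obtain ⟨y, hy⟩ := exists_ne (0 : I)
      obtain ⟨x, hx⟩ := hA v hv0 y
      rw [h2, LinearMap.zero_apply] at hx
      exact hy hx.symm
    have h3 := Subspace.finrank_add_finrank_dualCoannihilator_eq (LinearMap.range P)
    rw [h1, finrank_bot, add_zero] at h3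
    exact Submodule.eq_top_of_finrank_eq (h3.trans Subspace.dual_finrank_eq.symm)
  have heq : LinearMap.range Q = LinearMap.ker P := by
    refine Submodule.eq_of_le_of_finrank_eq hQP ?_
    have h1 := LinearMap.finrank_range_of_inj hQinj
    have h2 := LinearMap.finrank_range_add_finrank_ker P
    rw [hPsurj, finrank_top, Module.finrank_fintype_fun_eq_card, Subspace.dual_finrank_eq] at h2
    rw [Subspace.dual_finrank_eq] at h1
    omega
  have hφ : ∀ φ : Dual K I, φ (∑ j, d j • i j) = ∑ j, d j * Q φ j := fun φ => by simp [hQ]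
  constructor
  · intro h0 x hx
    have hx' : x ∈ LinearMap.range Q := by rw [heq, LinearMap.mem_ker, hP, hx]
    obtain ⟨φ, rfl⟩ := hx'
    rw [← hφ, h0, map_zero]
  · intro h0
    rw [← Module.forall_dual_apply_eq_zero_iff K]
    intro φ
    rw [hφ]
    refine h0 _ ?_
    rw [← hP]
    exact hQP ⟨φ, rfl⟩

/-- If `dim W + 1` vectors span `W` and have sum zero, this is their only relation. -/
theorem ker_linearCombination_eq [FiniteDimensional K W] [Fintype ι]
    (hι : Fintype.card ι = finrank K W + 1) {w : ι → W} (hsum : ∑ j, w j = 0)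
    (hspan : Submodule.span K (Set.range w) = ⊤) :
    LinearMap.ker (Fintype.linearCombination K w) = Submodule.span K {fun _ => 1} := by
  have hne : Nonempty ι := Fintype.card_pos_iff.mp (by omega)
  have h1 : (fun _ => 1 : ι → K) ≠ 0 := fun h0 => one_ne_zero (congrFun h0 (Classical.arbitrary ι))
  symm
  refine Submodule.eq_of_le_of_finrank_eq ?_ ?_
  · rw [Submodule.span_singleton_le_iff_mem, LinearMap.mem_ker, Fintype.linearCombination_apply]
    simpa using hsum
  · have h2 := LinearMap.finrank_range_add_finrank_ker (Fintype.linearCombination K w)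
    rw [Fintype.range_linearCombination, hspan, finrank_top,
      Module.finrank_fintype_fun_eq_card] at h2
    rw [finrank_span_singleton h1]
    omega

/-- Two surjective linear maps with the same kernel differ by an isomorphism of their targets. -/
theorem exists_equiv_of_ker_eq {E F G : Type*} [AddCommGroup E] [Module K E] [AddCommGroup F]
    [Module K F] [AddCommGroup G] [Module K G] {f : E →ₗ[K] F} {g : E →ₗ[K] G}
    (hf : Function.Surjective f) (hg : Function.Surjective g)
    (h : LinearMap.ker f = LinearMap.ker g) : ∃ α : F ≃ₗ[K] G, ∀ x, α (f x) = g x := by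
  refine ⟨(f.quotKerEquivOfSurjective hf).symm ≪≫ₗ Submodule.quotEquivOfEq _ _ h ≪≫ₗ
    g.quotKerEquivOfSurjective hg, fun x => ?_⟩
  have h1 : (f.quotKerEquivOfSurjective hf).symm (f x) = Submodule.Quotient.mk x := by
    rw [LinearEquiv.symm_apply_eq]
    rfl
  simp only [LinearEquiv.trans_apply, h1]
  rfl

/-- If `dim I = 1`, the bilinear map is a perfect pairing between `V` and `W`. -/
theorem exists_equiv_of_finrank_eq_one [FiniteDimensional K V] [FiniteDimensional K W]
    {A : V →ₗ[K] W →ₗ[K] I} (hA : ∀ v ≠ 0, Function.Surjective (A v))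
    (hdim : finrank K W = finrank K V) (hI : finrank K I = 1) :
    ∃ β : W ≃ₗ[K] Dual K V, ∀ v w, β w v = 0 ↔ A v w = 0 := by
  have : FiniteDimensional K I := Module.finite_of_finrank_eq_succ hI
  let e : I ≃ₗ[K] K := LinearEquiv.ofFinrankEq _ _ (by rw [hI, finrank_self])
  let D : V →ₗ[K] Dual K W := transpose A e
  have hD : ∀ v w, D v w = e (A v w) := fun _ _ => rfl
  have he : (e : I →ₗ[K] K) ≠ 0 := by
    intro h0
    have : e (e.symm 1) = 0 := LinearMap.congr_fun h0 _
    rw [LinearEquiv.apply_symm_apply] at this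
    exact one_ne_zero this
  have hinj : Function.Injective D := by
    rw [injective_iff_map_eq_zero]
    intro v hv
    exact (eq_zero_or_eq_zero_of_transpose_eq_zero hA hv).resolve_left he
  have hsurj : Function.Surjective D := by
    rwa [← LinearMap.injective_iff_surjective_of_finrank_eq_finrank]
    rw [Subspace.dual_finrank_eq, hdim]
  have hflip : Function.Injective D.flip := by
    rw [injective_iff_map_eq_zero]
    intro w hw
    rw [← Module.forall_dual_apply_eq_zero_iff K]
    intro φ
    obtain ⟨v, rfl⟩ := hsurj φ
    exact LinearMap.congr_fun hw v
  refine ⟨LinearEquiv.ofInjectiveOfFinrankEq D.flip hflip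
    (by rw [Subspace.dual_finrank_eq, hdim]), fun v w => ?_⟩
  change D v w = 0 ↔ _
  rw [hD, LinearEquiv.map_eq_zero_iff]

/-- Two bilinear maps `A`, `A'` of the Steiner type with `dim W + 1` common unstable hyperplanes
`ξ j = 0` have the same family of kernels up to a linear automorphism of `W`. -/
theorem exists_equiv_forall_apply_eq_zero_iff [IsAlgClosed K] [FiniteDimensional K V]
    [FiniteDimensional K W] [FiniteDimensional K I] [Nontrivial V] [Fintype ι]
    {A A' : V →ₗ[K] W →ₗ[K] I}
    (hA : ∀ v ≠ 0, Function.Surjective (A v)) (hA' : ∀ v ≠ 0, Function.Surjective (A' v))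
    (hdim : finrank K W + 1 = finrank K V + finrank K I)
    (hι : Fintype.card ι = finrank K W + 1) {w w' : ι → W} {ξ : ι → Dual K V} {i i' : ι → I}
    (hw : ∀ j, w j ≠ 0) (hw' : ∀ j, w' j ≠ 0)
    (hξ : ∀ j j', j ≠ j' → LinearIndependent K ![ξ j, ξ j'])
    (h : ∀ v j, A v (w j) = ξ j v • i j) (h' : ∀ v j, A' v (w' j) = ξ j v • i' j) :
    ∃ α : W ≃ₗ[K] W, ∀ v x, A v x = 0 ↔ A' v (α x) = 0 := by
  rcases Nat.lt_or_ge (finrank K I) 2 with hI | hI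
  · interval_cases hI' : finrank K I
    · have : Subsingleton I := Module.finrank_zero_iff.mp hI'
      exact ⟨LinearEquiv.refl K W, fun v x => by simp [eq_iff_true_of_subsingleton]⟩
    · obtain ⟨β, hβ⟩ := exists_equiv_of_finrank_eq_one hA (by omega) hI'
      obtain ⟨β', hβ'⟩ := exists_equiv_of_finrank_eq_one hA' (by omega) hI'
      exact ⟨β ≪≫ₗ β'.symm, fun v x => by rw [← hβ, ← hβ']; simp⟩
  · have : Nontrivial I := Module.nontrivial_of_finrank_pos (R := K) (by omega)
    obtain ⟨u, y, hy, hu, hus⟩ := exists_sum_eq_zero hA hdim hI hι hw hξ h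
    obtain ⟨u', y', hy', hu', hus'⟩ := exists_sum_eq_zero hA' hdim hI hι hw' hξ h'
    have hsurj : ∀ {u : ι → W}, Submodule.span K (Set.range u) = ⊤ →
        Function.Surjective (Fintype.linearCombination K u) := fun hs => by
      rw [← LinearMap.range_eq_top, Fintype.range_linearCombination, hs]
    obtain ⟨α, hα⟩ := exists_equiv_of_ker_eq (hsurj hus) (hsurj hus')
      ((ker_linearCombination_eq hι hu hus).trans (ker_linearCombination_eq hι hu' hus').symm)
    refine ⟨α, fun v x => ?_⟩
    obtain ⟨d, rfl⟩ := hsurj hus x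
    have hcomb : ∀ {B : V →ₗ[K] W →ₗ[K] I} {u : ι → W} {y : ι → I},
        (∀ v j, B v (u j) = ξ j v • y j) →
        B v (Fintype.linearCombination K u d) = ∑ j, (d j * ξ j v) • y j := fun hB => by
      simp [Fintype.linearCombination_apply, hB, mul_smul]
    rw [hα, hcomb hy, hcomb hy', sum_smul_eq_zero_iff hA (by omega) hy hu hus,
      sum_smul_eq_zero_iff hA' (by omega) hy' hu' hus']

end Steiner

/-! ### Regular functions on projective space and on hyperplanes -/

namespace MvPolynomial

theorem IsHomogeneous.eval_smul {R σ : Type*} [CommSemiring R] {p : MvPolynomial σ R} {d : ℕ}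
    (hp : p.IsHomogeneous d) (c : R) (v : σ → R) : eval (c • v) p = c ^ d * eval v p := by
  rw [eval_eq, eval_eq, Finset.mul_sum]
  refine Finset.sum_congr rfl fun m hm => ?_
  have hd : ∑ i ∈ m.support, m i = d := by
    rw [← hp (mem_support_iff.mp hm), ← Finsupp.degree_apply, Finsupp.degree_eq_weight_one]
    rfl
  simp only [Pi.smul_apply, smul_eq_mul, mul_pow, Finset.prod_mul_distrib]
  rw [Finset.prod_pow_eq_pow_sum, hd]
  ring

/-- A function on `ℂᵐ` minus the origin, `m ≥ 2`, which is locally a quotient of polynomials is a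
polynomial: by the Nullstellensatz its ideal of denominators contains powers of two variables,
and these are coprime. -/
theorem exists_forall_eq_eval_of_locally_div {K σ : Type*} [Field K] [IsAlgClosed K] [Finite σ]
    [Nontrivial σ] (g : (σ → K) → K)
    (hg : ∀ u ≠ 0, ∃ p q : MvPolynomial σ K, eval u q ≠ 0 ∧
      ∀ v ≠ 0, g v * eval v q = eval v p) :
    ∃ P : MvPolynomial σ K, ∀ u ≠ 0, g u = eval u P := by
  let D : Ideal (MvPolynomial σ K) :=
    { carrier := {q | ∃ p, ∀ v ≠ 0, g v * eval v q = eval v p}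
      zero_mem' := ⟨0, fun v _ => by simp⟩
      add_mem' := by
        rintro q q' ⟨p, hp⟩ ⟨p', hp'⟩
        exact ⟨p + p', fun v hv => by rw [map_add, mul_add, hp v hv, hp' v hv, map_add]⟩
      smul_mem' := by
        rintro c q ⟨p, hp⟩
        exact ⟨c * p, fun v hv => by rw [smul_eq_mul, map_mul, map_mul, ← hp v hv]; ring⟩ }
  have hX : ∀ i, ∃ N : ℕ, (X i ^ N : MvPolynomial σ K) ∈ D := by
    intro i
    have h1 : (X i : MvPolynomial σ K) ∈ D.radical := by
      rw [← vanishingIdeal_zeroLocus_eq_radical (K := K), mem_vanishingIdeal_iff]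
      intro u hu
      rw [mem_zeroLocus_iff] at hu
      have hu0 : u = 0 := by
        by_contra h0
        obtain ⟨p, q, hq, hpq⟩ := hg u h0
        exact hq (by simpa [aeval_eq_eval] using hu q ⟨p, hpq⟩)
      simp [hu0]
    exact h1
  obtain ⟨i, j, hij⟩ := exists_pair_ne σ
  obtain ⟨N, P₀, h₀⟩ := hX i
  obtain ⟨M, P₁, h₁⟩ := hX j
  have hne : ∀ (u : σ → K) (i : σ), u i ≠ 0 → u ≠ 0 := fun u i hu h0 => hu (congrFun h0 i)
  have hcross : X j ^ M * P₀ = X i ^ N * P₁ := by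
    have h2 : X i * X j * (X j ^ M * P₀) = X i * X j * (X i ^ N * P₁) := by
      refine MvPolynomial.funext fun u => ?_
      by_cases hu : u i = 0
      · simp [hu]
      · have hu0 := hne u i hu
        simp only [map_mul]
        rw [← h₀ u hu0, ← h₁ u hu0]
        ring
    exact mul_left_cancel₀ (mul_ne_zero (X_ne_zero i) (X_ne_zero j)) h2
  have hdvd : X i ^ N ∣ P₀ := by
    refine (X_prime (R := K) (i := i)).pow_dvd_of_dvd_mul_left N (a := X j ^ M) (fun h3 => ?_)
      ⟨P₁, hcross⟩
    exact hij (X_dvd_X.mp ((X_prime (R := K) (i := i)).dvd_of_dvd_pow h3))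
  obtain ⟨P, rfl⟩ := hdvd
  have hP : ∀ u, u i ≠ 0 → g u = eval u P := by
    intro u hu
    have h2 := h₀ u (hne u i hu)
    simp only [map_mul, map_pow, eval_X] at h2
    rw [mul_comm] at h2
    exact mul_left_cancel₀ (pow_ne_zero N hu) h2
  refine ⟨P, fun u hu => ?_⟩
  obtain ⟨p, q, hq, hpq⟩ := hg u hu
  have h2 : q * P = p := by
    have h3 : X i * (q * P) = X i * p := by
      refine MvPolynomial.funext fun v => ?_
      by_cases hv : v i = 0
      · simp [hv]
      · simp only [map_mul]
        rw [← hpq v (hne v i hv), ← hP v hv]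
        ring
    exact mul_left_cancel₀ (X_ne_zero i) h3
  have h4 := hpq u hu
  rw [← h2, map_mul, mul_comm] at h4
  exact mul_left_cancel₀ hq h4

theorem differentiable_eval {𝕜 σ : Type*} [NontriviallyNormedField 𝕜] [Fintype σ]
    (P : MvPolynomial σ 𝕜) : Differentiable 𝕜 fun v : σ → 𝕜 => eval v P := by
  induction P using MvPolynomial.induction_on with
  | C a => simp
  | add p q hp hq =>
    simp only [map_add]
    exact hp.add hq
  | mul_X p i hp =>
    simp only [map_mul, eval_X]
    exact hp.mul (differentiable_apply i)

theorem continuous_eval_smul {𝕜 σ : Type*} [NontriviallyNormedField 𝕜] [Fintype σ]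
    (P : MvPolynomial σ 𝕜) (u : σ → 𝕜) : Continuous fun t : 𝕜 => eval (t • u) P :=
  P.differentiable_eval.continuous.comp (by fun_prop)

/-- A polynomial function which is homogeneous of degree `0` is constant. -/
theorem eval_eq_eval_zero_of_forall_smul {𝕜 σ : Type*} [NontriviallyNormedField 𝕜] [Fintype σ]
    {P : MvPolynomial σ 𝕜} {u : σ → 𝕜} (h : ∀ t : 𝕜, t ≠ 0 → eval (t • u) P = eval u P) :
    eval u P = eval 0 P := by
  have h1 := (P.continuous_eval_smul u).ext_on (dense_compl_singleton (0 : 𝕜)) continuous_const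
    fun t ht => h t ht
  simpa using (congrFun h1 0).symm

/-- A polynomial function which is homogeneous of degree `1` is linear. -/
theorem exists_linearMap_of_forall_smul {𝕜 σ : Type*} [NontriviallyNormedField 𝕜] [Fintype σ]
    {P : MvPolynomial σ 𝕜} (h : ∀ (t : 𝕜) (u : σ → 𝕜), t ≠ 0 → u ≠ 0 →
      eval (t • u) P = t * eval u P) : ∃ l : (σ → 𝕜) →ₗ[𝕜] 𝕜, ∀ u ≠ 0, eval u P = l u := by
  refine ⟨(fderiv 𝕜 (fun v : σ → 𝕜 => eval v P) 0).toLinearMap, fun u hu => ?_⟩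
  have h1 := (P.continuous_eval_smul u).ext_on (dense_compl_singleton (0 : 𝕜))
    (g := fun t => t * eval u P) (by fun_prop) fun t ht => h t u ht hu
  have h2 : HasDerivAt (fun t : 𝕜 => t • u) u 0 := by
    simpa using (hasDerivAt_id (0 : 𝕜)).smul_const u
  have h3 : HasFDerivAt (fun v : σ → 𝕜 => eval v P) (fderiv 𝕜 (fun v : σ → 𝕜 => eval v P) 0)
      ((0 : 𝕜) • u) := by
    rw [zero_smul]
    exact (P.differentiable_eval 0).hasFDerivAt
  have h4 := h3.comp_hasDerivAt 0 h2
  have h5 : HasDerivAt (fun t : 𝕜 => t * eval u P) (eval u P) 0 := by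
    simpa using (hasDerivAt_id (0 : 𝕜)).mul_const (eval u P)
  exact h5.unique (h1 ▸ h4)

end MvPolynomial

namespace ProjSpace

open MvPolynomial

variable {n : ℕ}

theorem isOpen_nonvanishingAt {d : ℕ} {h : MvPolynomial (Fin (n + 1)) ℂ} (hd : h.IsHomogeneous d) :
    IsOpen[zariski n] {x | NonvanishingAt h x} :=
  fun _ hx => ⟨d, h, hd, hx, fun _ hy => hy⟩

/-- The local denominators of a regular function can be chosen such that the quotient formula,
with the denominator cleared, holds everywhere. -/
theorem isRegularFunction_iff {X : Set (ProjSpace n)} {f : X → ℂ} :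
    IsRegularFunction f ↔ ∀ x : X, ∃ (d : ℕ) (p q : MvPolynomial (Fin (n + 1)) ℂ),
      p.IsHomogeneous d ∧ q.IsHomogeneous d ∧ eval (x : ProjSpace n).rep q ≠ 0 ∧
        ∀ y : X, f y * eval (y : ProjSpace n).rep q = eval (y : ProjSpace n).rep p := by
  constructor
  · intro hf x
    obtain ⟨U, hU, hxU, d, p, q, hp, hq, h⟩ := hf x
    obtain ⟨e, r, hr, hrx, hrU⟩ := hU x hxU
    refine ⟨e + d, r * p, r * q, hr.mul hp, hr.mul hq, ?_, fun y => ?_⟩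
    · rw [map_mul]
      exact mul_ne_zero hrx (h x hxU).1
    · rw [map_mul, map_mul]
      by_cases hy : eval (y : ProjSpace n).rep r = 0
      · simp [hy]
      · obtain ⟨h1, h2⟩ := h y (hrU y hy)
        rw [h2]
        have : eval (y : ProjSpace n).rep q ≠ 0 := h1
        field_simp
  · intro hf x
    obtain ⟨d, p, q, hp, hq, hqx, h⟩ := hf x
    exact ⟨_, isOpen_nonvanishingAt hq, hqx, d, p, q, hp, hq, fun y hy =>
      ⟨hy, (eq_div_iff hy).mpr (h y)⟩⟩

/-- The algebra of regular functions on a subset of projective space. -/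
def regularSubalgebra (X : Set (ProjSpace n)) : Subalgebra ℂ (X → ℂ) where
  carrier := {f | IsRegularFunction f}
  mul_mem' := by
    intro f g hf hg
    rw [Set.mem_ofPred_eq, isRegularFunction_iff] at *
    intro x
    obtain ⟨d, p, q, hp, hq, hqx, h⟩ := hf x
    obtain ⟨d', p', q', hp', hq', hqx', h'⟩ := hg x
    refine ⟨d + d', p * p', q * q', hp.mul hp', hq.mul hq', ?_, fun y => ?_⟩
    · rw [map_mul]
      exact mul_ne_zero hqx hqx'
    · rw [map_mul, map_mul, ← h, ← h', Pi.mul_apply]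
      ring
  add_mem' := by
    intro f g hf hg
    rw [Set.mem_ofPred_eq, isRegularFunction_iff] at *
    intro x
    obtain ⟨d, p, q, hp, hq, hqx, h⟩ := hf x
    obtain ⟨d', p', q', hp', hq', hqx', h'⟩ := hg x
    refine ⟨d + d', p * q' + q * p', q * q', (hp.mul hq').add (hq.mul hp'), hq.mul hq', ?_,
      fun y => ?_⟩
    · rw [map_mul]
      exact mul_ne_zero hqx hqx'
    · rw [map_add, map_mul, map_mul, map_mul, ← h, ← h', Pi.add_apply]
      ring
  algebraMap_mem' c := by
    rw [Set.mem_ofPred_eq, isRegularFunction_iff]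
    exact fun x => ⟨0, C c, 1, isHomogeneous_C _ _, isHomogeneous_one _ _, by simp, by simp⟩

theorem IsRegularFunction.restrict {X Y : Set (ProjSpace n)} {f : X → ℂ}
    (hf : IsRegularFunction f) (h : Y ⊆ X) :
    IsRegularFunction fun y : Y => f ⟨y, h y.2⟩ := by
  rw [isRegularFunction_iff] at *
  intro y
  obtain ⟨d, p, q, hp, hq, hqx, hpq⟩ := hf ⟨y, h y.2⟩
  exact ⟨d, p, q, hp, hq, hqx, fun z => hpq ⟨z, h z.2⟩⟩

/-- Regularity is local for the Zariski topology. -/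
theorem isRegularFunction_of_locally {X : Set (ProjSpace n)} {f : X → ℂ}
    (h : ∀ x : X, ∃ D : Set (ProjSpace n), IsOpen[zariski n] D ∧ (x : ProjSpace n) ∈ D ∧
      IsRegularFunction fun y : ↥(X ∩ D) => f ⟨y, y.2.1⟩) : IsRegularFunction f := by
  intro x
  obtain ⟨D, hD, hxD, hf⟩ := h x
  obtain ⟨U, hU, hxU, d, p, q, hp, hq, hpq⟩ := hf ⟨x, x.2, hxD⟩
  exact ⟨U ∩ D, (zariski n).isOpen_inter _ _ hU hD, ⟨hxU, hxD⟩, d, p, q, hp, hq,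
    fun y hy => hpq ⟨y, y.2, hy.2⟩ hy.1⟩

/-- A function which is locally a quotient of regular functions is regular. -/
theorem isRegularFunction_of_forall_mul_eq {X : Set (ProjSpace n)} {f : X → ℂ}
    (h : ∀ x : X, ∃ k g : X → ℂ, IsRegularFunction k ∧ IsRegularFunction g ∧ k x ≠ 0 ∧
      ∀ y, f y * k y = g y) : IsRegularFunction f := by
  rw [isRegularFunction_iff]
  intro x
  obtain ⟨k, g, hk, hg, hkx, hkg⟩ := h x
  obtain ⟨d, p, q, hp, hq, hqx, h1⟩ := isRegularFunction_iff.mp hk x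
  obtain ⟨d', p', q', hp', hq', hqx', h2⟩ := isRegularFunction_iff.mp hg x
  refine ⟨d + d', q * p', p * q', hq.mul hp', hp.mul hq', ?_, fun y => ?_⟩
  · rw [map_mul, ← h1]
    exact mul_ne_zero (mul_ne_zero hkx hqx) hqx'
  · rw [map_mul, map_mul, ← h1, ← h2, ← hkg]
    ring

/-- The quotient formula of a regular function can be evaluated at any representatives. -/
theorem IsRegularFunction.exists_mul_eval_eq {X : Set (ProjSpace n)} {f : X → ℂ}
    (hf : IsRegularFunction f) {v : Fin (n + 1) → ℂ} (hv : v ≠ 0)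
    (hx : Projectivization.mk ℂ v hv ∈ X) : ∃ p q : MvPolynomial (Fin (n + 1)) ℂ, eval v q ≠ 0 ∧
      ∀ (u : Fin (n + 1) → ℂ) (hu : u ≠ 0) (hy : Projectivization.mk ℂ u hu ∈ X),
        f ⟨Projectivization.mk ℂ u hu, hy⟩ * eval u q = eval u p := by
  obtain ⟨d, p, q, hp, hq, hqx, h⟩ := isRegularFunction_iff.mp hf ⟨_, hx⟩
  refine ⟨p, q, ?_, fun u hu hy => ?_⟩
  · obtain ⟨c, hc⟩ := Projectivization.exists_smul_eq_mk_rep ℂ v hv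
    rw [← hc, Units.smul_def, hq.eval_smul] at hqx
    exact right_ne_zero_of_mul hqx
  · obtain ⟨c, hc⟩ := Projectivization.exists_smul_eq_mk_rep ℂ u hu
    have h1 := h ⟨_, hy⟩
    rw [← hc, Units.smul_def, hq.eval_smul, hp.eval_smul, mul_left_comm] at h1
    exact mul_left_cancel₀ (pow_ne_zero d c.ne_zero) h1

namespace Hyperplane

theorem mk_mem_points {H : Hyperplane n} {v : Fin (n + 1) → ℂ} (hv : v ≠ 0) :
    Projectivization.mk ℂ v hv ∈ H.points ↔ H.rep v = 0 := by
  obtain ⟨c, hc⟩ := Projectivization.exists_smul_eq_mk_rep ℂ v hv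
  rw [points, Set.mem_ofPred_eq, ← hc, Units.smul_def, map_smul, smul_eq_zero,
    or_iff_right c.ne_zero]

theorem finrank_ker_rep (H : Hyperplane n) : Module.finrank ℂ (LinearMap.ker H.rep) = n := by
  have h := Module.Dual.finrank_ker_add_one_of_ne_zero H.rep_nonzero
  rw [Module.finrank_fintype_fun_eq_card, Fintype.card_fin] at h
  omega

theorem points_eq_empty (H : Hyperplane 0) : H.points = ∅ := by
  rw [Set.eq_empty_iff_forall_notMem]
  intro x hx
  have h1 : LinearMap.ker H.rep = ⊥ := Submodule.finrank_eq_zero.mp H.finrank_ker_rep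
  have h2 : x.rep ∈ LinearMap.ker H.rep := hx
  rw [h1, Submodule.mem_bot] at h2
  exact x.rep_nonzero h2

/-- A regular function on a hyperplane is constant. -/
theorem eq_of_isRegularFunction {H : Hyperplane n} {f : H.points → ℂ} (hf : IsRegularFunction f)
    (x y : H.points) : f x = f y := by
  let L : (Fin n → ℂ) ≃ₗ[ℂ] LinearMap.ker H.rep := LinearEquiv.ofFinrankEq _ _ (by
    rw [Module.finrank_fintype_fun_eq_card, Fintype.card_fin, H.finrank_ker_rep])
  have hL0 : ∀ u ≠ 0, (L u : Fin (n + 1) → ℂ) ≠ 0 := fun u hu h0 =>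
    hu (L.map_eq_zero_iff.mp (Submodule.coe_eq_zero.mp h0))
  have hLmem : ∀ u (hu : u ≠ 0), Projectivization.mk ℂ _ (hL0 u hu) ∈ H.points := fun u hu =>
    (mk_mem_points _).mpr (L u).2
  have hsurj : ∀ x : H.points, ∃ (u : Fin n → ℂ) (hu : u ≠ 0),
      x = ⟨Projectivization.mk ℂ _ (hL0 u hu), hLmem u hu⟩ := by
    intro x
    obtain ⟨u, hu⟩ := L.surjective ⟨(x : ProjSpace n).rep, x.2⟩
    have hu' : (L u : Fin (n + 1) → ℂ) = (x : ProjSpace n).rep := congrArg Subtype.val hu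
    have hu0 : u ≠ 0 := by
      rintro rfl
      rw [map_zero] at hu'
      exact (x : ProjSpace n).rep_nonzero hu'.symm
    refine ⟨u, hu0, Subtype.ext ?_⟩
    simp only [hu', Projectivization.mk_rep]
  have hsmul : ∀ (t : ℂ) (u : Fin n → ℂ) (hu : u ≠ 0) (htu : t • u ≠ 0),
      f ⟨Projectivization.mk ℂ _ (hL0 _ htu), hLmem _ htu⟩ =
        f ⟨Projectivization.mk ℂ _ (hL0 u hu), hLmem u hu⟩ := by
    intro t u hu htu
    congr 2
    rw [Projectivization.mk_eq_mk_iff']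
    exact ⟨t, by rw [map_smul, Submodule.coe_smul]⟩
  obtain ⟨u, hu, rfl⟩ := hsurj x
  obtain ⟨u', hu', rfl⟩ := hsurj y
  rcases Nat.lt_or_ge n 2 with hn | hn
  · -- a hyperplane of the projective line is a point
    interval_cases n
    · exact absurd (Subsingleton.elim _ _) hu
    · have h0 : u' 0 ≠ 0 := fun h0 => hu' (funext fun i => by rw [Subsingleton.elim i 0, h0]; rfl)
      have h1 : u = (u 0 / u' 0) • u' := funext fun i => by
        rw [Subsingleton.elim i 0, Pi.smul_apply, smul_eq_mul, div_mul_cancel₀ _ h0]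
      have h2 := hsmul (u 0 / u' 0) u' hu' (h1 ▸ hu)
      rw [← h2]
      congr 2
      rw [Projectivization.mk_eq_mk_iff']
      exact ⟨1, by rw [one_smul, ← h1]⟩
  · have : Nontrivial (Fin n) := Fin.nontrivial_iff_two_le.mpr hn
    classical
    let g : (Fin n → ℂ) → ℂ := fun u =>
      if hu : u = 0 then 0 else f ⟨Projectivization.mk ℂ _ (hL0 u hu), hLmem u hu⟩
    have hg : ∀ u (hu : u ≠ 0), g u = f ⟨Projectivization.mk ℂ _ (hL0 u hu), hLmem u hu⟩ :=
      fun u hu => dif_neg hu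
    let s : Fin (n + 1) → MvPolynomial (Fin n) ℂ := fun i =>
      ∑ j, C ((L (Pi.single j 1) : Fin (n + 1) → ℂ) i) * X j
    have hs : ∀ (u : Fin n → ℂ) (p : MvPolynomial (Fin (n + 1)) ℂ),
        eval u (bind₁ s p) = eval (L u : Fin (n + 1) → ℂ) p := by
      intro u p
      have h2 : (fun i => eval u (s i)) = (L u : Fin (n + 1) → ℂ) := by
        funext i
        have h3 : u = ∑ j, u j • (Pi.single j 1 : Fin n → ℂ) := by
          funext i
          simp [Finset.sum_apply, Pi.single_apply]
        conv_rhs => rw [h3]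
        simp [s, mul_comm]
      have h4 : (aeval u).comp (bind₁ s) = aeval (L u : Fin (n + 1) → ℂ) := by
        ext1 i
        simpa [aeval_eq_eval] using congrFun h2 i
      simpa [aeval_eq_eval] using DFunLike.congr_fun h4 p
    obtain ⟨P, hP⟩ := exists_forall_eq_eval_of_locally_div g fun u hu => by
      obtain ⟨p, q, hq, hpq⟩ := hf.exists_mul_eval_eq (hL0 u hu) (hLmem u hu)
      refine ⟨bind₁ s p, bind₁ s q, by rwa [hs], fun v hv => ?_⟩
      rw [hs, hs, hg v hv]
      exact hpq _ (hL0 v hv) (hLmem v hv)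
    have hconst : ∀ u (hu : u ≠ 0), g u = eval 0 P := by
      intro u hu
      rw [hP u hu]
      refine eval_eq_eval_zero_of_forall_smul fun t ht => ?_
      rw [← hP u hu, ← hP _ (smul_ne_zero ht hu), hg u hu, hg _ (smul_ne_zero ht hu),
        hsmul t u hu (smul_ne_zero ht hu)]
    rw [← hg u hu, ← hg u' hu', hconst u hu, hconst u' hu']

end Hyperplane

end ProjSpace

/-! ### From bundles to bilinear maps and back -/

namespace ProjSpace

variable {n : ℕ}

/-- **Cramer's rule** for regular functions: if a matrix `M` of regular functions has a left inverse
at every point, then the solution of `M * N = M'` with a regular right hand side is regular. -/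
theorem isRegularFunction_of_matrix_mul_eq {X : Set (ProjSpace n)} {m r s : ℕ}
    {M : X → Matrix (Fin m) (Fin r) ℂ} {N : X → Matrix (Fin r) (Fin s) ℂ}
    {M' : X → Matrix (Fin m) (Fin s) ℂ} (hM : ∀ c a, IsRegularFunction fun x => M x c a)
    (hM' : ∀ c b, IsRegularFunction fun x => M' x c b) (h : ∀ x, M x * N x = M' x)
    (hinv : ∀ x, ∃ L : Matrix (Fin r) (Fin m) ℂ, L * M x = 1) (a : Fin r) (b : Fin s) :
    IsRegularFunction fun x => N x a b := by
  refine isRegularFunction_of_forall_mul_eq fun x₀ => ?_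
  -- a left inverse of `M x₀` makes `det (L * M)` a regular function that does not vanish at `x₀`
  obtain ⟨L, hL⟩ := hinv x₀
  let ev : ∀ x : X, regularSubalgebra X →ₐ[ℂ] ℂ := fun x =>
    (Pi.evalAlgHom ℂ (fun _ : X => ℂ) x).comp (regularSubalgebra X).val
  let Lr : Matrix (Fin r) (Fin m) (regularSubalgebra X) := L.map (algebraMap ℂ _)
  let Mr : Matrix (Fin m) (Fin r) (regularSubalgebra X) := fun c a => ⟨fun x => M x c a, hM c a⟩
  let Mr' : Matrix (Fin m) (Fin s) (regularSubalgebra X) := fun c b => ⟨fun x => M' x c b, hM' c b⟩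
  have hLr : ∀ x, Lr.map (ev x) = L := fun x => by
    ext i j
    simp [Lr]
  have hMr : ∀ x, Mr.map (ev x) = M x := fun x => rfl
  have hMr' : ∀ x, Mr'.map (ev x) = M' x := fun x => rfl
  have hdet : ∀ x, ev x (Lr * Mr).det = (L * M x).det := fun x => by
    rw [AlgHom.map_det, AlgHom.mapMatrix_apply, Matrix.map_mul, hLr, hMr]
  have hadj : ∀ x, ((Lr * Mr).adjugate * (Lr * Mr')).map (ev x) =
      (L * M x).adjugate * (L * M' x) := fun x => by
    rw [Matrix.map_mul, ← AlgHom.mapMatrix_apply, AlgHom.map_adjugate, AlgHom.mapMatrix_apply,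
      Matrix.map_mul, hLr, hMr, Matrix.map_mul, hLr, hMr']
  refine ⟨((Lr * Mr).det : regularSubalgebra X),
    (((Lr * Mr).adjugate * (Lr * Mr')) a b : regularSubalgebra X), Subtype.prop _, Subtype.prop _,
    ?_, fun x => ?_⟩
  · have h1 := hdet x₀
    rw [hL, Matrix.det_one] at h1
    exact h1.trans_ne one_ne_zero
  · have h1 : ev x (((Lr * Mr).adjugate * (Lr * Mr')) a b) =
        ((L * M x).adjugate * (L * M' x)) a b := congrFun (congrFun (hadj x) a) b
    change N x a b * ev x (Lr * Mr).det = ev x (((Lr * Mr).adjugate * (Lr * Mr')) a b)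
    rw [h1, hdet, ← h, ← Matrix.mul_assoc L, ← Matrix.mul_assoc, Matrix.adjugate_mul,
      Matrix.smul_mul, Matrix.one_mul, Matrix.smul_apply, smul_eq_mul, mul_comm]

theorem mem_submodule_mk {v : Fin (n + 1) → ℂ} (hv : v ≠ 0) :
    v ∈ (Projectivization.mk ℂ v hv).submodule := by
  rw [Projectivization.submodule_mk]
  exact Submodule.mem_span_singleton_self v

theorem eq_mk_of_mem_submodule {x : ProjSpace n} {v : Fin (n + 1) → ℂ} (hx : v ∈ x.submodule)
    (hv : v ≠ 0) : x = Projectivization.mk ℂ v hv := by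
  rw [Projectivization.submodule_eq, Submodule.mem_span_singleton] at hx
  obtain ⟨t, ht⟩ := hx
  rw [← x.mk_rep, eq_comm, Projectivization.mk_eq_mk_iff']
  exact ⟨t, ht⟩

end ProjSpace

namespace AlgVectorBundle

open ProjSpace MvPolynomial

variable {n : ℕ}

instance (E : AlgVectorBundle n) (x : ProjSpace n) : FiniteDimensional ℂ (E.Fiber x) := by
  obtain ⟨i, hi⟩ := E.cover x
  exact Module.Finite.equiv (E.triv i ⟨x, hi⟩).symm

theorem sum_smul_triv_symm (E : AlgVectorBundle n) {i : E.Chart} (x : E.dom i) (v : E.Fiber x) :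
    ∑ a, E.triv i x v a • (E.triv i x).symm (Pi.single a 1) = v := by
  apply (E.triv i x).injective
  rw [map_sum]
  simp only [map_smul, LinearEquiv.apply_symm_apply]
  exact (pi_eq_sum_univ' (E.triv i x v)).symm

/-- The `a`-th coordinate in a local trivialization, a local section of the dual bundle. -/
noncomputable def coordForm (E : AlgVectorBundle n) {i : E.Chart} (x : E.dom i) (a : Fin E.rank) :
    Module.Dual ℂ (E.Fiber x) :=
  LinearMap.proj a ∘ₗ (E.triv i x).toLinearMap

theorem coordForm_apply (E : AlgVectorBundle n) {i : E.Chart} (x : E.dom i) (a : Fin E.rank)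
    (v : E.Fiber x) : E.coordForm x a v = E.triv i x v a := rfl

theorem dual_triv_symm_single (E : AlgVectorBundle n) {i : E.Chart} (x : E.dom i)
    (a : Fin E.rank) : (E.dual.triv i x).symm (Pi.single a 1) = E.coordForm x a := by
  refine (LinearEquiv.symm_apply_eq _).mpr (funext fun b : Fin E.rank => ?_)
  have h1 : ((E.triv i x).symm.dualMap ≪≫ₗ (Module.piEquiv (Fin E.rank) ℂ ℂ).symm)
      (E.coordForm x a) b = (Pi.single b 1 : Fin E.rank → ℂ) a := by
    simp [Module.piEquiv, coordForm]
  exact (Pi.single_comm a (1 : ℂ) b).trans h1.symm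

theorem sum_smul_coordForm (E : AlgVectorBundle n) {i : E.Chart} (x : E.dom i)
    (l : Module.Dual ℂ (E.Fiber x)) :
    ∑ a, l ((E.triv i x).symm (Pi.single a 1)) • E.coordForm x a = l := by
  ext v
  conv_rhs => rw [← E.sum_smul_triv_symm x v]
  simp [coordForm_apply, mul_comm]

/-- The linear maps on the fibres of a morphism from a dual bundle to a trivial one. -/
noncomputable def Hom.ofDual {m : ℕ} {S : AlgVectorBundle n} (φ : Hom S.dual (trivialBundle n m))
    (x : ProjSpace n) : Module.Dual ℂ (S.Fiber x) →ₗ[ℂ] (Fin m → ℂ) :=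
  φ.map x

/-- The linear maps on the fibres of a morphism from a trivial bundle to `I ⊗ 𝒪(1)`. -/
noncomputable def Hom.toTwist {m k : ℕ} (f : Hom (trivialBundle n m) (twist n k))
    (x : ProjSpace n) :
    (Fin m → ℂ) →ₗ[ℂ] x.submodule →ₗ[ℂ] (Fin k → ℂ) :=
  f.map x

theorem Hom.isRegularFunction_ofDual {m : ℕ} {S : AlgVectorBundle n}
    (φ : Hom S.dual (trivialBundle n m)) (i : S.Chart) (a : Fin S.rank) (c : Fin m) :
    IsRegularFunction fun x : S.dom i => φ.ofDual x (S.coordForm x a) c := by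
  have h1 : IsRegularFunction (X := S.dom i ∩ Set.univ) fun x =>
      φ.ofDual x ((S.dual.triv i ⟨x, x.2.1⟩).symm (Pi.single a 1)) c := φ.regular i () a c
  have h2 : (fun x : ↥(S.dom i ∩ Set.univ) =>
      φ.ofDual x ((S.dual.triv i ⟨x, x.2.1⟩).symm (Pi.single a 1)) c) =
      fun x : ↥(S.dom i ∩ Set.univ) => φ.ofDual x (S.coordForm ⟨x, x.2.1⟩ a) c := funext fun x =>
    congrArg (fun l => φ.ofDual x l c) (S.dual_triv_symm_single ⟨x, x.2.1⟩ a)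
  exact (h2 ▸ h1).restrict (Y := S.dom i) fun z hz => ⟨hz, trivial⟩

/-- A morphism from a trivial bundle to `I ⊗ 𝒪(1)` is a bilinear map, since the global sections of
`𝒪(1)` are the linear forms. -/
theorem exists_bilinear_of_hom_trivialBundle_twist (hn : n ≠ 0) {m k : ℕ}
    (f : Hom (trivialBundle n m) (twist n k)) :
    ∃ A : (Fin (n + 1) → ℂ) →ₗ[ℂ] (Fin m → ℂ) →ₗ[ℂ] (Fin k → ℂ),
      ∀ (v : Fin (n + 1) → ℂ) (hv : v ≠ 0) (w : Fin m → ℂ),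
        A v w = f.toTwist (Projectivization.mk ℂ v hv) w ⟨v, mem_submodule_mk hv⟩ := by
  classical
  let F := f.toTwist
  have hF : ∀ (x : ProjSpace n) (v : Fin (n + 1) → ℂ) (hx : v ∈ x.submodule) (hv : v ≠ 0) w,
      F x w ⟨v, hx⟩ = F (Projectivization.mk ℂ v hv) w ⟨v, mem_submodule_mk hv⟩ := by
    intro x v hx hv w
    obtain rfl := eq_mk_of_mem_submodule hx hv
    rfl
  have key : ∀ (a : Fin m) (b : Fin k), ∃ l : (Fin (n + 1) → ℂ) →ₗ[ℂ] ℂ, ∀ v (hv : v ≠ 0),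
      F (Projectivization.mk ℂ v hv) (Pi.single a 1) ⟨v, mem_submodule_mk hv⟩ b = l v := by
    intro a b
    let g : (Fin (n + 1) → ℂ) → ℂ := fun v => if hv : v = 0 then 0 else
      F (Projectivization.mk ℂ v hv) (Pi.single a 1) ⟨v, mem_submodule_mk hv⟩ b
    have hg : ∀ v (hv : v ≠ 0), g v =
        F (Projectivization.mk ℂ v hv) (Pi.single a 1) ⟨v, mem_submodule_mk hv⟩ b :=
      fun v hv => dif_neg hv
    have hscale : ∀ (x : ProjSpace n) v (hx : v ∈ x.submodule), v ≠ 0 →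
        F x (Pi.single a 1) ⟨v, hx⟩ b = g v := fun x v hx hv => by rw [hF x v hx hv, hg v hv]
    have hsmul : ∀ (t : ℂ) (v : Fin (n + 1) → ℂ), t ≠ 0 → v ≠ 0 → g (t • v) = t * g v := by
      intro t v ht hv
      have hmem := mem_submodule_mk hv
      rw [← hscale (Projectivization.mk ℂ v hv) (t • v) (Submodule.smul_mem _ _ hmem)
        (smul_ne_zero ht hv), ← hscale (Projectivization.mk ℂ v hv) v hmem hv, ← smul_eq_mul,
        ← Pi.smul_apply, ← map_smul]
      rfl
    have : Nontrivial (Fin (n + 1)) := Fin.nontrivial_iff_two_le.mpr (by omega)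
    obtain ⟨P, hP⟩ := exists_forall_eq_eval_of_locally_div g fun u hu => by
      obtain ⟨i, hi⟩ := Function.ne_iff.mp hu
      have hmem : ∀ v (hv : v ≠ 0), v i ≠ 0 →
          Projectivization.mk ℂ v hv ∈ Set.univ ∩ coordOpen n i := by
        intro v hv hvi
        obtain ⟨c, hc⟩ := Projectivization.exists_smul_eq_mk_rep ℂ v hv
        refine ⟨trivial, ?_⟩
        rw [coordOpen, Set.mem_ofPred_eq, ← hc]
        exact mul_ne_zero c.ne_zero hvi
      have hreg : IsRegularFunction (X := Set.univ ∩ coordOpen n i) fun x =>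
          twistTriv n k i ⟨x, x.2.2⟩ (F x (Pi.single a 1)) b := f.regular () i a b
      obtain ⟨p, q, hq, hpq⟩ := hreg.exists_mul_eval_eq hu (hmem u hu hi)
      refine ⟨p * X i * X i, q * X i, by simpa using ⟨hq, hi⟩, fun v hv => ?_⟩
      by_cases hvi : v i = 0
      · simp [hvi]
      · have h1 := hpq v hv (hmem v hv hvi)
        have h2 : twistTriv n k i ⟨Projectivization.mk ℂ v hv, (hmem v hv hvi).2⟩
            (F (Projectivization.mk ℂ v hv) (Pi.single a 1)) b = (v i)⁻¹ * g v := by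
          rw [← hsmul _ _ (inv_ne_zero hvi) hv]
          obtain ⟨c, hc⟩ := Projectivization.exists_smul_eq_mk_rep ℂ v hv
          have h3 : ((Projectivization.mk ℂ v hv).rep i)⁻¹ • (Projectivization.mk ℂ v hv).rep =
              (v i)⁻¹ • v := by
            rw [← hc, Units.smul_def, Pi.smul_apply, smul_eq_mul, smul_smul, mul_inv,
              mul_right_comm, inv_mul_cancel₀ c.ne_zero, one_mul]
          rw [← h3]
          exact hscale _ _ _ (h3 ▸ smul_ne_zero (inv_ne_zero hvi) hv)
        rw [h2] at h1
        simp only [map_mul, eval_X]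
        rw [← h1]
        field_simp
    obtain ⟨l, hl⟩ := exists_linearMap_of_forall_smul (P := P) fun t u ht hu => by
      rw [← hP u hu, ← hP _ (smul_ne_zero ht hu), hsmul t u ht hu]
    exact ⟨l, fun v hv => by rw [← hg v hv, hP v hv, hl v hv]⟩
  choose l hl using key
  refine ⟨LinearMap.mk₂ ℂ (fun v w b => ∑ a, w a * l a b v) ?_ ?_ ?_ ?_, fun v hv w => ?_⟩
  · intros
    ext b
    simp [mul_add, Finset.sum_add_distrib]
  · intros
    ext b
    simp [Finset.mul_sum, mul_left_comm]
  · intros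
    ext b
    simp [add_mul, Finset.sum_add_distrib]
  · intros
    ext b
    simp [Finset.mul_sum, mul_assoc]
  · change _ = F (Projectivization.mk ℂ v hv) w ⟨v, mem_submodule_mk hv⟩
    ext b
    have h1 := congrArg (F (Projectivization.mk ℂ v hv)) (pi_eq_sum_univ' w)
    rw [map_sum] at h1
    rw [h1, LinearMap.sum_apply, Finset.sum_apply]
    change ∑ a, w a * l a b v = _
    refine Finset.sum_congr rfl fun a _ => ?_
    rw [map_smul, LinearMap.smul_apply, Pi.smul_apply, smul_eq_mul, hl]

theorem toTwist_mk_eq_zero_iff {m k : ℕ} {f : Hom (trivialBundle n m) (twist n k)}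
    {A : (Fin (n + 1) → ℂ) →ₗ[ℂ] (Fin m → ℂ) →ₗ[ℂ] (Fin k → ℂ)}
    (hA : ∀ (v : Fin (n + 1) → ℂ) (hv : v ≠ 0) (w : Fin m → ℂ),
      A v w = f.toTwist (Projectivization.mk ℂ v hv) w ⟨v, mem_submodule_mk hv⟩)
    {v : Fin (n + 1) → ℂ} (hv : v ≠ 0) (w : Fin m → ℂ) :
    f.toTwist (Projectivization.mk ℂ v hv) w = 0 ↔ A v w = 0 := by
  rw [hA v hv]
  constructor
  · intro h
    rw [h]
    rfl
  · intro h
    refine LinearMap.ext fun ⟨u, hu⟩ => ?_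
    obtain ⟨t, rfl⟩ := Submodule.mem_span_singleton.mp
      (Projectivization.submodule_mk (K := ℂ) v hv ▸ hu)
    have h1 : (⟨t • v, hu⟩ : (Projectivization.mk ℂ v hv).submodule) =
      t • ⟨v, mem_submodule_mk hv⟩ := rfl
    rw [h1, map_smul, h, smul_zero]
    rfl

theorem surjective_of_isShortExact {m k : ℕ} {E : AlgVectorBundle n}
    {φ : Hom E (trivialBundle n m)} {f : Hom (trivialBundle n m) (twist n k)}
    (h : IsShortExact φ f) {A : (Fin (n + 1) → ℂ) →ₗ[ℂ] (Fin m → ℂ) →ₗ[ℂ] (Fin k → ℂ)}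
    (hA : ∀ (v : Fin (n + 1) → ℂ) (hv : v ≠ 0) (w : Fin m → ℂ),
      A v w = f.toTwist (Projectivization.mk ℂ v hv) w ⟨v, mem_submodule_mk hv⟩)
    (v : Fin (n + 1) → ℂ) (hv : v ≠ 0) :
    Function.Surjective (A v) := by
  intro y
  obtain ⟨i, hi⟩ := Function.ne_iff.mp hv
  -- the linear map on the line through `v` with value `y` at `v`
  let l : (Projectivization.mk ℂ v hv).submodule →ₗ[ℂ] (Fin k → ℂ) :=
    (LinearMap.toSpanSingleton ℂ (Fin k → ℂ) ((v i)⁻¹ • y)) ∘ₗ (LinearMap.proj i) ∘ₗ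
      (Projectivization.mk ℂ v hv).submodule.subtype
  obtain ⟨w, hw⟩ : ∃ w, f.toTwist (Projectivization.mk ℂ v hv) w = l :=
    (h (Projectivization.mk ℂ v hv)).2.2 l
  refine ⟨w, ?_⟩
  rw [hA v hv, hw]
  change v i • (v i)⁻¹ • y = y
  rw [smul_smul, mul_inv_cancel₀ hi, one_smul]

/-- A section of the restriction of `E` to a hyperplane has constant image in a trivial bundle. -/
theorem map_eq_of_isRegularSection {m : ℕ} {E : AlgVectorBundle n} (φ : Hom E (trivialBundle n m))
    {H : Hyperplane n} {s : ∀ x : H.points, E.Fiber x} (hs : E.IsRegularSection s)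
    (x y : H.points) : (φ.map x (s x) : Fin m → ℂ) = φ.map y (s y) := by
  let G : ∀ x : ProjSpace n, E.Fiber x →ₗ[ℂ] (Fin m → ℂ) := φ.map
  change G x (s x) = G y (s y)
  ext b
  refine Hyperplane.eq_of_isRegularFunction (f := fun x => G x (s x) b) ?_ x y
  refine isRegularFunction_of_locally fun x => ?_
  obtain ⟨i, hi⟩ := E.cover x
  refine ⟨E.dom i, E.isOpen_dom i, hi, ?_⟩
  have h1 : (fun z : ↥(H.points ∩ E.dom i) => G z (s ⟨z, z.2.1⟩) b) =
      ∑ a, (fun z : ↥(H.points ∩ E.dom i) => E.triv i ⟨z, z.2.2⟩ (s ⟨z, z.2.1⟩) a) *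
        fun z : ↥(H.points ∩ E.dom i) =>
          G z ((E.triv i ⟨z, z.2.2⟩).symm (Pi.single a 1)) b := by
    funext z
    conv_lhs => rw [← E.sum_smul_triv_symm ⟨z, z.2.2⟩ (s ⟨z, z.2.1⟩)]
    simp [Finset.sum_apply]
  rw [h1]
  refine (regularSubalgebra _).sum_mem fun a _ => (regularSubalgebra _).mul_mem (hs i a) ?_
  have h2 : IsRegularFunction (X := E.dom i ∩ Set.univ) fun z =>
    G z ((E.triv i ⟨z, z.2.1⟩).symm (Pi.single a 1)) b := φ.regular i () a b
  exact h2.restrict (Y := H.points ∩ E.dom i) fun z hz => ⟨hz.2, trivial⟩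

/-- An unstable hyperplane `ξ = 0` gives a nonzero `w ∈ W` with `A v w = ξ v • y`. -/
theorem exists_of_mem_unstableHyperplanes {m k : ℕ} {S : AlgVectorBundle n}
    {φ : Hom S.dual (trivialBundle n m)} {f : Hom (trivialBundle n m) (twist n k)}
    (h : IsShortExact φ f) {A : (Fin (n + 1) → ℂ) →ₗ[ℂ] (Fin m → ℂ) →ₗ[ℂ] (Fin k → ℂ)}
    (hA : ∀ (v : Fin (n + 1) → ℂ) (hv : v ≠ 0) (w : Fin m → ℂ),
      A v w = f.toTwist (Projectivization.mk ℂ v hv) w ⟨v, mem_submodule_mk hv⟩)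
    {H : Hyperplane n} (hH : H ∈ S.unstableHyperplanes) :
    ∃ (w : Fin m → ℂ) (y : Fin k → ℂ), w ≠ 0 ∧ ∀ v, A v w = H.rep v • y := by
  obtain ⟨s, hs, hs0⟩ := hH
  obtain ⟨x, hx⟩ := Function.ne_iff.mp hs0
  let w : Fin m → ℂ := φ.map x (s x)
  have hker : ∀ v, H.rep v = 0 → A v w = 0 := by
    intro v hv
    by_cases hv0 : v = 0
    · rw [hv0, map_zero, LinearMap.zero_apply]
    · rw [← toTwist_mk_eq_zero_iff hA hv0]
      have h1 : w = φ.ofDual (Projectivization.mk ℂ v hv0)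
          (s ⟨_, (Hyperplane.mk_mem_points hv0).mpr hv⟩) :=
        map_eq_of_isRegularSection φ hs x ⟨_, (Hyperplane.mk_mem_points hv0).mpr hv⟩
      rw [h1]
      exact ((h _).2.1 _).mpr ⟨_, rfl⟩
  obtain ⟨v₁, hv₁⟩ : ∃ v₁, H.rep v₁ ≠ 0 := by
    by_contra! hall
    exact H.rep_nonzero (LinearMap.ext hall)
  refine ⟨w, (H.rep v₁)⁻¹ • A v₁ w, fun hw => hx ?_, fun v => ?_⟩
  · exact (h x).1 (Eq.trans hw (map_zero (φ.ofDual x)).symm)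
  · have h1 := hker (v - (H.rep v * (H.rep v₁)⁻¹) • v₁) (by
      rw [map_sub, map_smul, smul_eq_mul, mul_assoc, inv_mul_cancel₀ hv₁, mul_one, sub_self])
    rw [map_sub, map_smul, LinearMap.sub_apply, LinearMap.smul_apply, sub_eq_zero] at h1
    rw [h1, smul_smul]

/-- A family of linear maps between the fibres of dual bundles which becomes a constant linear map
`β` after embedding into trivial bundles is the transpose of a morphism of vector bundles. -/
theorem exists_hom_of_dual {m : ℕ} {S S' : AlgVectorBundle n}
    {φ : Hom S.dual (trivialBundle n m)} {φ' : Hom S'.dual (trivialBundle n m)}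
    (hφ : ∀ x, Function.Injective (φ.ofDual x)) (β : (Fin m → ℂ) →ₗ[ℂ] (Fin m → ℂ))
    (ψ : ∀ x, Module.Dual ℂ (S'.Fiber x) →ₗ[ℂ] Module.Dual ℂ (S.Fiber x))
    (hψ : ∀ x l, φ.ofDual x (ψ x l) = β (φ'.ofDual x l)) :
    ∃ Φ : Hom S S', ∀ x v (l : Module.Dual ℂ (S'.Fiber x)), l (Φ.map x v) = ψ x l v := by
  let Ψ : ∀ x, S.Fiber x →ₗ[ℂ] S'.Fiber x := fun x =>
    (Module.evalEquiv ℂ (S'.Fiber x)).symm.toLinearMap ∘ₗ (ψ x).dualMap ∘ₗ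
      Module.Dual.eval ℂ (S.Fiber x)
  have hΨ : ∀ x v (l : Module.Dual ℂ (S'.Fiber x)), l (Ψ x v) = ψ x l v := by
    intro x v l
    simp [Ψ]
  refine ⟨⟨Ψ, fun i j a b => ?_⟩, hΨ⟩
  let X := S.dom i ∩ S'.dom j
  have hrw : (fun x : X => S'.triv j ⟨x, x.2.2⟩
      (Ψ x ((S.triv i ⟨x, x.2.1⟩).symm (Pi.single a 1))) b) = fun x : X =>
      ψ x (S'.coordForm ⟨x, x.2.2⟩ b) ((S.triv i ⟨x, x.2.1⟩).symm (Pi.single a 1)) := by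
    funext x
    rw [← coordForm_apply, hΨ]
  rw [hrw]
  -- the matrices of `φ`, `β ∘ φ'` and `ψ` in the local frames of the dual bundles
  refine isRegularFunction_of_matrix_mul_eq
    (M := fun x : X => Matrix.of fun c a => φ.ofDual x (S.coordForm ⟨x, x.2.1⟩ a) c)
    (M' := fun x : X => Matrix.of fun c b => β (φ'.ofDual x (S'.coordForm ⟨x, x.2.2⟩ b)) c)
    (N := fun x : X => Matrix.of fun a b =>
      ψ x (S'.coordForm ⟨x, x.2.2⟩ b) ((S.triv i ⟨x, x.2.1⟩).symm (Pi.single a 1))) ?_ ?_ ?_ ?_ a b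
  · intro c a
    exact (φ.isRegularFunction_ofDual i a c).restrict (Y := X) fun z hz => hz.1
  · intro c b
    have h1 : (fun x : X => β (φ'.ofDual x (S'.coordForm ⟨x, x.2.2⟩ b)) c) =
        ∑ c', β (Pi.single c' 1) c • fun x : X =>
          φ'.ofDual x (S'.coordForm ⟨x, x.2.2⟩ b) c' := by
      funext x
      conv_lhs => rw [pi_eq_sum_univ' (φ'.ofDual x (S'.coordForm ⟨x, x.2.2⟩ b))]
      simp only [map_sum, map_smul, Finset.sum_apply, Pi.smul_apply, smul_eq_mul]
      exact Finset.sum_congr rfl fun c' _ => mul_comm _ _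
    change IsRegularFunction fun x : X => β (φ'.ofDual x (S'.coordForm ⟨x, x.2.2⟩ b)) c
    rw [h1]
    exact (regularSubalgebra X).sum_mem fun c' _ => (regularSubalgebra X).smul_mem
      ((φ'.isRegularFunction_ofDual j b c').restrict (Y := X) fun z hz => hz.2) _
  · intro x
    ext c b
    have h1 := congrArg (fun l => φ.ofDual x l c)
      (S.sum_smul_coordForm ⟨x, x.2.1⟩ (ψ x (S'.coordForm ⟨x, x.2.2⟩ b)))
    simp only [map_sum, map_smul, Finset.sum_apply, Pi.smul_apply, smul_eq_mul] at h1
    rw [Matrix.mul_apply, Matrix.of_apply, ← hψ, ← h1]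
    exact Finset.sum_congr rfl fun a _ => mul_comm _ _
  · intro x
    obtain ⟨L, hL⟩ := (φ.ofDual x).exists_leftInverse_of_injective
      (LinearMap.ker_eq_bot.mpr (hφ x))
    refine ⟨Matrix.of fun a c => L (Pi.single c 1) ((S.triv i ⟨x, x.2.1⟩).symm (Pi.single a 1)), ?_⟩
    ext a a'
    have h1 : L (φ.ofDual x (S.coordForm ⟨x, x.2.1⟩ a')) = S.coordForm ⟨x, x.2.1⟩ a' :=
      LinearMap.congr_fun hL _
    rw [pi_eq_sum_univ' (φ.ofDual x (S.coordForm ⟨x, x.2.1⟩ a')), map_sum] at h1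
    have h2 := LinearMap.congr_fun h1 ((S.triv i ⟨x, x.2.1⟩).symm (Pi.single a 1))
    rw [coordForm_apply, LinearEquiv.apply_symm_apply] at h2
    simp only [map_smul, LinearMap.sum_apply, LinearMap.smul_apply, smul_eq_mul] at h2
    rw [Matrix.mul_apply, Matrix.one_apply, ← Pi.single_apply, Pi.single_comm, ← h2]
    exact Finset.sum_congr rfl fun c _ => mul_comm _ _

theorem exists_comp_eq_of_forall_mem_range {K E F W : Type*} [Field K] [AddCommGroup E] [Module K E]
    [AddCommGroup F] [Module K F] [AddCommGroup W] [Module K W] {φ : F →ₗ[K] W}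
    (hφ : Function.Injective φ) {g : E →ₗ[K] W} (hg : ∀ e, g e ∈ LinearMap.range φ) :
    ∃ ψ : E →ₗ[K] F, ∀ e, φ (ψ e) = g e := by
  refine ⟨(LinearEquiv.ofInjective φ hφ).symm.toLinearMap ∘ₗ g.codRestrict _ hg, fun e => ?_⟩
  exact congrArg Subtype.val ((LinearEquiv.ofInjective φ hφ).apply_symm_apply ⟨g e, hg e⟩)

/-- Two Steiner bundles are isomorphic if the kernels of their defining maps correspond under an
automorphism of `W`. -/
theorem isIsomorphic_of_forall_toTwist_eq_zero_iff {m k : ℕ} {S S' : AlgVectorBundle n}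
    {φ : Hom S.dual (trivialBundle n m)} {f : Hom (trivialBundle n m) (twist n k)}
    {φ' : Hom S'.dual (trivialBundle n m)} {f' : Hom (trivialBundle n m) (twist n k)}
    (h : IsShortExact φ f) (h' : IsShortExact φ' f') (α : (Fin m → ℂ) ≃ₗ[ℂ] (Fin m → ℂ))
    (hα : ∀ x w, f.toTwist x w = 0 ↔ f'.toTwist x (α w) = 0) : IsIsomorphic S S' := by
  have hinj : ∀ x, Function.Injective (φ.ofDual x) := fun x => (h x).1
  have hinj' : ∀ x, Function.Injective (φ'.ofDual x) := fun x => (h' x).1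
  have hex : ∀ x w, f.toTwist x w = 0 ↔ w ∈ LinearMap.range (φ.ofDual x) := fun x => (h x).2.1
  have hex' : ∀ x w, f'.toTwist x w = 0 ↔ w ∈ LinearMap.range (φ'.ofDual x) := fun x => (h' x).2.1
  choose ψ hψ using fun x => exists_comp_eq_of_forall_mem_range (hinj' x)
    (g := α.toLinearMap ∘ₗ φ.ofDual x) fun l => by
      rw [← hex', LinearMap.comp_apply, LinearEquiv.coe_coe, ← hα, hex]
      exact ⟨l, rfl⟩
  choose ψ' hψ' using fun x => exists_comp_eq_of_forall_mem_range (hinj x)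
    (g := α.symm.toLinearMap ∘ₗ φ'.ofDual x) fun l => by
      rw [← hex, LinearMap.comp_apply, LinearEquiv.coe_coe, hα, LinearEquiv.apply_symm_apply, hex']
      exact ⟨l, rfl⟩
  obtain ⟨Φ, hΦ⟩ := exists_hom_of_dual hinj α.symm.toLinearMap ψ' hψ'
  obtain ⟨Φ', hΦ'⟩ := exists_hom_of_dual hinj' α.toLinearMap ψ hψ
  refine ⟨Φ, Φ', fun x => ⟨LinearMap.ext fun v => ?_, LinearMap.ext fun v => ?_⟩⟩
  · rw [← sub_eq_zero, ← Module.forall_dual_apply_eq_zero_iff ℂ]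
    intro l
    have h3 : ψ' x (ψ x l) = l := hinj x (by
      rw [hψ', LinearMap.comp_apply, hψ]
      exact α.symm_apply_apply _)
    rw [map_sub, LinearMap.comp_apply, hΦ', hΦ, h3, LinearMap.id_apply, sub_self]
  · rw [← sub_eq_zero, ← Module.forall_dual_apply_eq_zero_iff ℂ]
    intro l
    have h3 : ψ x (ψ' x l) = l := hinj' x (by
      rw [hψ, LinearMap.comp_apply, hψ']
      exact α.apply_symm_apply _)
    rw [map_sub, LinearMap.comp_apply, hΦ, hΦ', h3, LinearMap.id_apply, sub_self]

end AlgVectorBundle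

open AlgVectorBundle in
theorem theorem5p3 (n k : ℕ) (S S' : AlgVectorBundle n)
    (hS : AlgVectorBundle.IsSteiner n k S) (hS' : AlgVectorBundle.IsSteiner n k S')
    (T : Finset (ProjSpace.Hyperplane n)) (hT : T.card = n + k + 1)
    (hTS : ∀ H ∈ T, H ∈ S.unstableHyperplanes ∧ H ∈ S'.unstableHyperplanes) :
    AlgVectorBundle.IsIsomorphic S S' := by
  obtain ⟨φ, f, h⟩ := hS
  obtain ⟨φ', f', h'⟩ := hS'
  obtain ⟨H₀, hH₀⟩ : T.Nonempty := Finset.card_pos.mp (by omega)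
  -- a hyperplane of a point is empty and hence not unstable
  have hn : n ≠ 0 := by
    rintro rfl
    obtain ⟨s, -, hs⟩ := (hTS H₀ hH₀).1
    obtain ⟨x, -⟩ := Function.ne_iff.mp hs
    exact (H₀.points_eq_empty ▸ x.2 : (x : ProjSpace 0) ∈ (∅ : Set _))
  obtain ⟨A, hA⟩ := exists_bilinear_of_hom_trivialBundle_twist hn f
  obtain ⟨A', hA'⟩ := exists_bilinear_of_hom_trivialBundle_twist hn f'
  choose w y hw hy using fun H : T => exists_of_mem_unstableHyperplanes h hA (hTS H H.2).1
  choose w' y' hw' hy' using fun H : T => exists_of_mem_unstableHyperplanes h' hA' (hTS H H.2).2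
  obtain ⟨α, hα⟩ := Steiner.exists_equiv_forall_apply_eq_zero_iff (ξ := fun H : T => H.1.rep)
    (surjective_of_isShortExact h hA) (surjective_of_isShortExact h' hA') (by simp; omega)
    (by simpa using hT) hw hw'
    (fun H H' hne => Projectivization.linearIndependent_pair_iff_ne.mpr fun he =>
      hne (Subtype.ext he)) (fun v H => hy H v) (fun v H => hy' H v)
  refine isIsomorphic_of_forall_toTwist_eq_zero_iff h h' α fun x u => ?_
  rw [← x.mk_rep]
  exact (toTwist_mk_eq_zero_iff hA x.rep_nonzero u).trans
    ((hα _ _).trans (toTwist_mk_eq_zero_iff hA' x.rep_nonzero (α u)).symm)
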